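/- Let $SH(2)$ be the Lie group of the matrices $$g=\begin{pmatrix}\cosh\varphi&\sinh\varphi&x\\ \sinh\varphi&\cosh\varphi&y\\0&0&1\end{pmatrix},\qquad \varphi,x,y\in\mathbb R,$$ with identity $e$, let $e_1=E_{12}+E_{21}$, $e_2=E_{13}$, $e_3=E_{23}$ be the standard basis of its Lie algebra $\mathfrak{sh}(2)$ (where $E_{ij}$ are the matrix units), and let $\langle\cdot,\cdot\rangle$ be the scalar product on $\mathfrak{sh}(2)$ for which $e_1,e_2,e_3$ are orthonormal. Put $\mathfrak p=\operatorname{span}(e_1,e_2)$, and let $d$ be the left-invariant sub-Riemannian metric on $SH(2)$ defined by $\mathfrak p$ with orthonormal basis $e_1,e_2$: $d(g,h)$ is the infimum of the lengths $\int_0^T|c(t)^{-1}\dot c(t)|\,dt$ of the piecewise smooth paths $c$ from $g$ to $h$ with $c^{-1}\dot c\in\mathfrak p$. A geodesic is a curve $g:\mathbb R\to SH(2)$ which is locally shortest and parametrized by arc length, i.e. every $t\in\mathbb R$ has a neighbourhood in which $d(g(s_1),g(s_2))=|s_1-s_2|$. For $\alpha,\beta\in\mathbb R$ put $\psi_0=\cos\alpha\,e_1+\sin\alpha\,e_2+\beta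 e_3$ and consider the vector field $v(g)=g\,u(g)$ on $SH(2)$, where $u(g)\in\mathfrak p$ is determined by $\langle u(g),w\rangle=\langle\psi_0,gwg^{-1}\rangle$ for all $w\in\mathfrak p$. 1. Every geodesic $g$ with $g(0)=e$ is an integral curve of this vector field for some $\alpha,\beta\in\mathbb R$. 2. Let $\alpha,\beta\in\mathbb R$, and let $g:\mathbb R\to SH(2)$ be an integral curve of this vector field with $g(0)=e$ (by 1, for suitable $\alpha,\beta$ this applies to every geodesic $g$ with $g(0)=e$). Then the coordinates $\varphi,x,y$ of $g(t)$ vanish at $t=0$, and there is a twice differentiable function $\gamma:\mathbb R\to\mathbb R$ with $$\cos\frac\gamma2=\sin\alpha\cosh\varphi+\beta\sinh\varphi,\qquad \sin\frac\gamma2=\cos\alpha-y\sin\alpha-\beta x,$$ such that $$\dot\varphi=\sin\frac\gamma2,\qquad \dot x=\cos\frac\gamma2\cosh\varphi,\qquad \dot y=\cos\frac\gamma2\sinh\varphi,$$ and $\gamma$ satisfies the pendulum equation $$\ddot\gamma=-\sin\gamma,\qquad \gamma(0)=\pi-2\alpha,\qquad \dot\gamma(0)=-2\beta.$$ -/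

import Mathlib

open scoped ContDiff ENNReal

noncomputable section

/-- The matrix with the coordinates `(φ, x, y)`. -/
def shMat (φ x y : ℝ) : Matrix (Fin 3) (Fin 3) ℝ :=
  !![Real.cosh φ, Real.sinh φ, x;
     Real.sinh φ, Real.cosh φ, y;
     0, 0, 1]

theorem shMat_zero : shMat 0 0 0 = 1 := by
  ext i j
  fin_cases i <;> fin_cases j <;> simp [shMat]

theorem shMat_mul (φ x y φ' x' y' : ℝ) :
    shMat φ x y * shMat φ' x' y' =
      shMat (φ + φ') (Real.cosh φ * x' + Real.sinh φ * y' + x)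
        (Real.sinh φ * x' + Real.cosh φ * y' + y) := by
  ext i j
  fin_cases i <;> fin_cases j <;>
    simp [shMat, Matrix.mul_apply, Fin.sum_univ_three, Real.cosh_add, Real.sinh_add] <;> ring

theorem shMat_mul_inv (φ x y : ℝ) :
    shMat φ x y *
      shMat (-φ) (-(Real.cosh φ * x) + Real.sinh φ * y) (Real.sinh φ * x - Real.cosh φ * y) = 1 := by
  have h := Real.cosh_sq φ
  rw [shMat_mul, ← shMat_zero]
  congr 1
  · ring
  · linear_combination (-x) * h
  · linear_combination (-y) * h

/-- The Lie group `SH(2)`, as a subgroup of `GL(3, ℝ)`. -/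
def SH2 : Subgroup (Matrix.GeneralLinearGroup (Fin 3) ℝ) where
  carrier := {g | ∃ φ x y : ℝ, (g : Matrix (Fin 3) (Fin 3) ℝ) = shMat φ x y}
  one_mem' := ⟨0, 0, 0, by simp [shMat_zero]⟩
  mul_mem' := by
    rintro a b ⟨φ, x, y, ha⟩ ⟨φ', x', y', hb⟩
    exact ⟨_, _, _, by rw [Units.val_mul, ha, hb, shMat_mul]⟩
  inv_mem' := by
    rintro a ⟨φ, x, y, ha⟩
    refine ⟨-φ, -(Real.cosh φ * x) + Real.sinh φ * y, Real.sinh φ * x - Real.cosh φ * y, ?_⟩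
    exact Units.inv_eq_of_mul_eq_one_right (by rw [ha]; exact shMat_mul_inv φ x y)

namespace SH2

/-- The underlying `3 × 3` matrix of an element of `SH(2)`. -/
def toMat (g : SH2) : Matrix (Fin 3) (Fin 3) ℝ :=
  ((g : Matrix.GeneralLinearGroup (Fin 3) ℝ) : Matrix (Fin 3) (Fin 3) ℝ)

/-- The basis `e₁, e₂, e₃` of the Lie algebra `𝔰𝔥(2)`. -/
def e₁ : Matrix (Fin 3) (Fin 3) ℝ := !![0, 1, 0; 1, 0, 0; 0, 0, 0]

def e₂ : Matrix (Fin 3) (Fin 3) ℝ := !![0, 0, 1; 0, 0, 0; 0, 0, 0]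

def e₃ : Matrix (Fin 3) (Fin 3) ℝ := !![0, 0, 0; 0, 0, 1; 0, 0, 0]

/-- The subspace `𝔭` of `𝔰𝔥(2)`, which defines the left-invariant distribution. -/
def horizontal : Submodule ℝ (Matrix (Fin 3) (Fin 3) ℝ) := Submodule.span ℝ {e₁, e₂}

/-- The scalar product on `𝔰𝔥(2)` for which `e₁, e₂, e₃` are orthonormal: an element
`a e₁ + b e₂ + c e₃` of `𝔰𝔥(2)` has `a, b, c` as its entries `(0,1), (0,2), (1,2)`. -/
def ip (v w : Matrix (Fin 3) (Fin 3) ℝ) : ℝ :=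
  v 0 1 * w 0 1 + v 0 2 * w 0 2 + v 1 2 * w 1 2

theorem ip_basis (a b c a' b' c' : ℝ) :
    ip (a • e₁ + b • e₂ + c • e₃) (a' • e₁ + b' • e₂ + c' • e₃) = a * a' + b * b' + c * c' := by
  simp [ip, e₁, e₂, e₃]

/-- The velocity of a curve in `SH(2)`, a tangent vector to `SH(2)` seen as a matrix. -/
def velocity (c : ℝ → SH2) (t : ℝ) : Matrix (Fin 3) (Fin 3) ℝ :=
  Matrix.of fun i j => deriv (fun s => toMat (c s) i j) t

/-- The velocity translated to the identity, `c(t)⁻¹ ċ(t)`. -/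
def bodyVelocity (c : ℝ → SH2) (t : ℝ) : Matrix (Fin 3) (Fin 3) ℝ :=
  toMat (c t)⁻¹ * velocity c t

/-- `c` restricted to `[0, T]` is a piecewise smooth path tangent to the left-invariant
distribution: it is smooth on each of the closed intervals of a finite partition of `[0, T]`, and
inside them `c(t)⁻¹ ċ(t) ∈ 𝔭`. -/
def IsHorizontalPath (c : ℝ → SH2) (T : ℝ) : Prop :=
  ∃ (n : ℕ) (τ : ℕ → ℝ), Monotone τ ∧ τ 0 = 0 ∧ τ n = T ∧
    ∀ k < n,
      (∀ i j, ContDiffOn ℝ ∞ (fun t => toMat (c t) i j) (Set.Icc (τ k) (τ (k + 1)))) ∧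
      ∀ t ∈ Set.Ioo (τ k) (τ (k + 1)), bodyVelocity c t ∈ horizontal

/-- The length of a path, measured with the left-invariant scalar product. -/
def pathLength (c : ℝ → SH2) (T : ℝ) : ℝ :=
  ∫ t in (0 : ℝ)..T, Real.sqrt (ip (bodyVelocity c t) (bodyVelocity c t))

/-- The left-invariant sub-Riemannian distance on `SH(2)` for which `e₁, e₂` is an orthonormal
basis of `𝔭`: the infimum of the lengths of the piecewise smooth horizontal paths from `g` to
`h`. -/
def sRdist (g h : SH2) : ℝ≥0∞ :=
  ⨅ (c : ℝ → SH2) (T : ℝ) (_ : IsHorizontalPath c T ∧ c 0 = g ∧ c T = h),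
    ENNReal.ofReal (pathLength c T)

/-- A geodesic (a locally shortest curve) of the sub-Riemannian metric, defined on `ℝ` and
parametrized by arc length. -/
def IsGeodesic (g : ℝ → SH2) : Prop :=
  ∀ t : ℝ, ∃ ε > 0, ∀ s₁ ∈ Set.Icc (t - ε) (t + ε), ∀ s₂ ∈ Set.Icc (t - ε) (t + ε),
    s₁ ≤ s₂ → sRdist (g s₁) (g s₂) = ENNReal.ofReal (s₂ - s₁)

/-- The covector `ψ₀ = cos α e₁ + sin α e₂ + β e₃`, seen as a vector through the scalar product. -/
def covector (α β : ℝ) : Matrix (Fin 3) (Fin 3) ℝ :=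
  Real.cos α • e₁ + Real.sin α • e₂ + β • e₃

/-- The adjoint action `Ad(g) w = g w g⁻¹`. -/
def Ad (g : SH2) (w : Matrix (Fin 3) (Fin 3) ℝ) : Matrix (Fin 3) (Fin 3) ℝ :=
  toMat g * w * toMat g⁻¹

/-- The vector `u(g) ∈ 𝔭` with `⟨u(g), w⟩ = ⟨ψ₀, Ad(g) w⟩` for all `w ∈ 𝔭`
(see `ip_control`). -/
def control (ψ₀ : Matrix (Fin 3) (Fin 3) ℝ) (g : SH2) : Matrix (Fin 3) (Fin 3) ℝ :=
  ip ψ₀ (Ad g e₁) • e₁ + ip ψ₀ (Ad g e₂) • e₂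

theorem ip_control (ψ₀ : Matrix (Fin 3) (Fin 3) ℝ) (g : SH2) (w : Matrix (Fin 3) (Fin 3) ℝ)
    (hw : w ∈ horizontal) : ip (control ψ₀ g) w = ip ψ₀ (Ad g w) := by
  obtain ⟨a, b, rfl⟩ := Submodule.mem_span_pair.1 hw
  simp only [Ad, Matrix.mul_add, Matrix.add_mul, Matrix.mul_smul, Matrix.smul_mul, control]
  simp [ip, e₁, e₂]
  ring

/-- `g` is an integral curve of the geodesic vector field `v(g) = g u(g)` of the covector `ψ₀`. -/
def IsExtremal (ψ₀ : Matrix (Fin 3) (Fin 3) ℝ) (g : ℝ → SH2) : Prop :=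
  ∀ t : ℝ, ∀ i j, HasDerivAt (fun s => toMat (g s) i j) ((toMat (g t) * control ψ₀ (g t)) i j) t

end SH2

end

/-! The pendulum is a computation. Along an integral curve let u, v be the coefficients of e₁, e₂ in
the control and let h = sin α sinh φ + β cosh φ. Then u' = -vh, v' = uh and h' = uv. So (u, v) =
(sin θ, cos θ) for a primitive θ of -h (`exists_angle`), and γ = 2θ satisfies γ'' = -2uv = -sin γ.

That geodesics are integral curves is derived directly from minimality, without the maximum
principle. A horizontal curve satisfies φ' = u₁, x' = u₂ cosh φ, y' = u₂ sinh φ. Estimates of the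
displacement by the distance (`displacement_le_of_sRdist_le`) make the coordinates of a shortest
path Lipschitz, so it has bounded measurable controls with u₁² + u₂² ≤ 1 almost everywhere
(`IsShortest.exists_controls`). Conversely, although the distance is defined by piecewise smooth
paths, it is at most √(T · energy) for measurable controls on [0, T] (`sRdist_le_of_isControl`).
Hence the controls of a shortest path minimize the energy among all measurable controls with the
same end points.

This problem is solved in two stages (`euler_lagrange`). For a fixed angle φ the end point imposes
two linear constraints on u₂, so the optimal u₂ is a combination of exp φ and exp(-φ). The resulting
least energy is an explicit functional of φ, whose first variation together with the lemma of du
Bois-Reymond gives the equation for φ'. The Gram determinant of exp φ and exp(-φ) must not vanish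
for this, which excludes constant φ; in that case the path is a straight line and is treated
separately.

Each piece of a geodesic thus has a covector. A unit speed extremal determines its covector near any
point (`isExtremalAt_unique`), so the covector is locally constant in time, hence constant on ℝ. -/

namespace SH2

/-! ### Coordinates on SH(2) and the extremal equations in them -/

/-- The element of `SH(2)` with the coordinates `(φ, x, y)`. -/
noncomputable def ofCoords (φ x y : ℝ) : SH2 :=
  ⟨⟨shMat φ x y,
    shMat (-φ) (-(Real.cosh φ * x) + Real.sinh φ * y) (Real.sinh φ * x - Real.cosh φ * y),
    shMat_mul_inv φ x y, mul_eq_one_comm.1 (shMat_mul_inv φ x y)⟩, φ, x, y, rfl⟩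

@[simp]
theorem toMat_ofCoords (φ x y : ℝ) : toMat (ofCoords φ x y) = shMat φ x y := rfl

theorem toMat_inv_ofCoords (φ x y : ℝ) : toMat (ofCoords φ x y)⁻¹ =
    shMat (-φ) (-(Real.cosh φ * x) + Real.sinh φ * y) (Real.sinh φ * x - Real.cosh φ * y) := rfl

theorem toMat_injective : Function.Injective toMat := fun _ _ h =>
  Subtype.ext (Units.ext h)

/-- The hyperbolic angle of an element of `SH(2)`. -/
noncomputable def rapidity (g : SH2) : ℝ := Real.arsinh (toMat g 1 0)

/-- The first translation coordinate of an element of `SH(2)`. -/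
def xCoord (g : SH2) : ℝ := toMat g 0 2

/-- The second translation coordinate of an element of `SH(2)`. -/
def yCoord (g : SH2) : ℝ := toMat g 1 2

@[simp]
theorem rapidity_ofCoords (φ x y : ℝ) : rapidity (ofCoords φ x y) = φ := by
  simp [rapidity, shMat]

@[simp]
theorem xCoord_ofCoords (φ x y : ℝ) : xCoord (ofCoords φ x y) = x := by simp [xCoord, shMat]

@[simp]
theorem yCoord_ofCoords (φ x y : ℝ) : yCoord (ofCoords φ x y) = y := by simp [yCoord, shMat]

@[simp]
theorem ofCoords_coords (g : SH2) : ofCoords (rapidity g) (xCoord g) (yCoord g) = g := by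
  obtain ⟨φ, x, y, h⟩ := g.2
  have : g = ofCoords φ x y := toMat_injective h
  rw [this]; simp

theorem toMat_eq (g : SH2) : toMat g = shMat (rapidity g) (xCoord g) (yCoord g) := by
  rw [← toMat_ofCoords, ofCoords_coords]

theorem toMat_one : toMat 1 = 1 := rfl

theorem ofCoords_zero : ofCoords 0 0 0 = 1 := toMat_injective shMat_zero

theorem rapidity_one : rapidity 1 = 0 := by rw [← ofCoords_zero]; simp
theorem xCoord_one : xCoord 1 = 0 := by rw [← ofCoords_zero]; simp
theorem yCoord_one : yCoord 1 = 0 := by rw [← ofCoords_zero]; simp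

theorem smul_e₁_add_smul_e₂ (a b : ℝ) : a • e₁ + b • e₂ = !![0, a, b; a, 0, 0; 0, 0, 0] := by
  ext i j; fin_cases i <;> fin_cases j <;> simp [e₁, e₂]

theorem shMat_mul_horizontal (φ x y a b : ℝ) : shMat φ x y * (a • e₁ + b • e₂) =
    !![Real.sinh φ * a, Real.cosh φ * a, Real.cosh φ * b;
       Real.cosh φ * a, Real.sinh φ * a, Real.sinh φ * b; 0, 0, 0] := by
  rw [smul_e₁_add_smul_e₂]
  ext i j; fin_cases i <;> fin_cases j <;> simp [shMat, Matrix.mul_apply, Fin.sum_univ_three]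

theorem control_covector (α β : ℝ) (g : SH2) : control (covector α β) g =
    (Real.cos α - yCoord g * Real.sin α - β * xCoord g) • e₁ +
    (Real.sin α * Real.cosh (rapidity g) + β * Real.sinh (rapidity g)) • e₂ := by
  obtain ⟨φ, x, y, h⟩ : ∃ φ x y, g = ofCoords φ x y := ⟨_, _, _, (ofCoords_coords g).symm⟩
  subst h
  have h := Real.cosh_sq φ
  rw [control, Ad, Ad, toMat_inv_ofCoords]
  simp only [toMat_ofCoords, rapidity_ofCoords, xCoord_ofCoords, yCoord_ofCoords]
  congr 2
  · simp [ip, covector, e₁, e₂, e₃, shMat, Matrix.mul_apply, Fin.sum_univ_three]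
    linear_combination (Real.cos α - y * Real.sin α - β * x) * h
  · simp [ip, covector, e₁, e₂, e₃, shMat, Matrix.mul_apply, Fin.sum_univ_three]

/-- A curve is tangent to the distribution with controls `a`, `b` at `t` in terms of
coordinates. -/
theorem hasDerivAt_coords {g : ℝ → SH2} {t a b : ℝ}
    (h : ∀ i j, HasDerivAt (fun s => toMat (g s) i j) ((toMat (g t) * (a • e₁ + b • e₂)) i j) t) :
    HasDerivAt (fun s => rapidity (g s)) a t ∧
    HasDerivAt (fun s => xCoord (g s)) (b * Real.cosh (rapidity (g t))) t ∧
    HasDerivAt (fun s => yCoord (g s)) (b * Real.sinh (rapidity (g t))) t := by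
  rw [toMat_eq, shMat_mul_horizontal] at h
  refine ⟨?_, ?_, ?_⟩
  · have h1 := (h 1 0).arsinh
    refine h1.congr_deriv ?_
    have : toMat (g t) 1 0 = Real.sinh (rapidity (g t)) := by simp [rapidity]
    rw [this, ← Real.cosh_sq', Real.sqrt_sq (Real.cosh_pos _).le]
    simp [(Real.cosh_pos _).ne']
  · refine (h 0 2).congr_deriv ?_
    simp [mul_comm]
  · refine (h 1 2).congr_deriv ?_
    simp [mul_comm]

theorem hasDerivAt_toMat {g : ℝ → SH2} {t a b : ℝ}
    (h1 : HasDerivAt (fun s => rapidity (g s)) a t)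
    (h2 : HasDerivAt (fun s => xCoord (g s)) (b * Real.cosh (rapidity (g t))) t)
    (h3 : HasDerivAt (fun s => yCoord (g s)) (b * Real.sinh (rapidity (g t))) t) :
    ∀ i j, HasDerivAt (fun s => toMat (g s) i j) ((toMat (g t) * (a • e₁ + b • e₂)) i j) t := by
  have e' : ∀ i j, (fun s => toMat (g s) i j) =
      fun s => shMat (rapidity (g s)) (xCoord (g s)) (yCoord (g s)) i j := by
    intro i j; funext s; rw [toMat_eq]
  intro i j
  rw [e', toMat_eq, shMat_mul_horizontal]
  fin_cases i <;> fin_cases j <;> simp [shMat]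
  · exact h1.cosh
  · exact h1.sinh
  · simpa [mul_comm] using h2
  · exact h1.sinh
  · exact h1.cosh
  · simpa [mul_comm] using h3
  · exact hasDerivAt_const _ _
  · exact hasDerivAt_const _ _
  · exact hasDerivAt_const _ _

/-- The matrix equation is replaced by three scalar ones; all later work is in these coordinates. -/
theorem isExtremal_covector_iff (α β : ℝ) (g : ℝ → SH2) :
    IsExtremal (covector α β) g ↔ ∀ t,
      HasDerivAt (fun s => rapidity (g s))
        (Real.cos α - yCoord (g t) * Real.sin α - β * xCoord (g t)) t ∧
      HasDerivAt (fun s => xCoord (g s))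
        ((Real.sin α * Real.cosh (rapidity (g t)) + β * Real.sinh (rapidity (g t))) *
          Real.cosh (rapidity (g t))) t ∧
      HasDerivAt (fun s => yCoord (g s))
        ((Real.sin α * Real.cosh (rapidity (g t)) + β * Real.sinh (rapidity (g t))) *
          Real.sinh (rapidity (g t))) t := by
  simp only [IsExtremal, control_covector]
  exact forall_congr' fun t => ⟨fun h => hasDerivAt_coords h, fun h =>
    hasDerivAt_toMat h.1 h.2.1 h.2.2⟩

/-! ### The pendulum equation -/

theorem eq_of_hasDerivAt_zero {f : ℝ → ℝ} (h : ∀ t, HasDerivAt f 0 t) (s t : ℝ) : f s = f t :=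
  is_const_of_deriv_eq_zero (fun t => (h t).differentiableAt) (fun t => (h t).deriv) s t

/-- A unit vector rotating with angular velocity `-h` has an angle function. -/
theorem exists_angle {u v h : ℝ → ℝ} {α : ℝ} (hh : Continuous h)
    (hu : ∀ t, HasDerivAt u (-(v t * h t)) t) (hv : ∀ t, HasDerivAt v (u t * h t) t)
    (hu0 : u 0 = Real.cos α) (hv0 : v 0 = Real.sin α) :
    ∃ θ : ℝ → ℝ, θ 0 = Real.pi / 2 - α ∧ (∀ t, HasDerivAt θ (-h t) t) ∧
      (∀ t, Real.sin (θ t) = u t) ∧ ∀ t, Real.cos (θ t) = v t := by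
  have hH : ∀ t, HasDerivAt (fun t => ∫ s in (0 : ℝ)..t, h s) (h t) t := fun t =>
    intervalIntegral.integral_hasDerivAt_right (hh.intervalIntegrable _ _)
      hh.stronglyMeasurable.stronglyMeasurableAtFilter hh.continuousAt
  set θ : ℝ → ℝ := fun t => Real.pi / 2 - α - ∫ s in (0 : ℝ)..t, h s with hθ
  have hθd : ∀ t, HasDerivAt θ (-h t) t := fun t => (hH t).const_sub _
  have hθ0 : θ 0 = Real.pi / 2 - α := by simp [hθ]
  -- Both (sin θ, cos θ) and (u, v) solve the same linear rotation equation, so their distance is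
  -- constant, and it is 0 at time 0.
  have key : ∀ t, (Real.sin (θ t) - u t) ^ 2 + (Real.cos (θ t) - v t) ^ 2 = 0 := by
    intro t
    have := eq_of_hasDerivAt_zero
      (f := fun t => (Real.sin (θ t) - u t) ^ 2 + (Real.cos (θ t) - v t) ^ 2) (fun t => by
        refine ((((hθd t).sin.sub (hu t)).pow 2).add
          (((hθd t).cos.sub (hv t)).pow 2)).congr_deriv ?_
        simp
        ring) t 0
    simpa [hθ0, hu0, hv0, Real.sin_pi_div_two_sub, Real.cos_pi_div_two_sub] using this
  refine ⟨θ, hθ0, hθd, fun t => ?_, fun t => ?_⟩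
  · have := key t
    nlinarith [sq_nonneg (Real.sin (θ t) - u t), sq_nonneg (Real.cos (θ t) - v t)]
  · have := key t
    nlinarith [sq_nonneg (Real.sin (θ t) - u t), sq_nonneg (Real.cos (θ t) - v t)]

/-- The third component h of the momentum is the angular velocity, up to sign, of the control vector
(u, v), and h' = uv. The factor 2 in γ = 2θ turns the product of sine and cosine into sin γ. -/
theorem IsExtremal.exists_pendulum {α β : ℝ} {g : ℝ → SH2} (hg : IsExtremal (covector α β) g)
    (h0 : g 0 = 1) :
    ∃ φ x y γ : ℝ → ℝ,
      (∀ t, toMat (g t) = shMat (φ t) (x t) (y t)) ∧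
      φ 0 = 0 ∧ x 0 = 0 ∧ y 0 = 0 ∧
      (∀ t, Real.cos (γ t / 2) = Real.sin α * Real.cosh (φ t) + β * Real.sinh (φ t)) ∧
      (∀ t, Real.sin (γ t / 2) = Real.cos α - y t * Real.sin α - β * x t) ∧
      (∀ t, HasDerivAt φ (Real.sin (γ t / 2)) t) ∧
      (∀ t, HasDerivAt x (Real.cos (γ t / 2) * Real.cosh (φ t)) t) ∧
      (∀ t, HasDerivAt y (Real.cos (γ t / 2) * Real.sinh (φ t)) t) ∧
      (∀ t, DifferentiableAt ℝ γ t) ∧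
      (∀ t, HasDerivAt (deriv γ) (-Real.sin (γ t)) t) ∧
      γ 0 = Real.pi - 2 * α ∧ deriv γ 0 = -2 * β := by
  rw [isExtremal_covector_iff] at hg
  set φ : ℝ → ℝ := fun s => rapidity (g s) with hφ
  set x : ℝ → ℝ := fun s => xCoord (g s) with hx
  set y : ℝ → ℝ := fun s => yCoord (g s) with hy
  have hφ0 : φ 0 = 0 := by simp [hφ, h0, rapidity_one]
  have hx0 : x 0 = 0 := by simp [hx, h0, xCoord_one]
  have hy0 : y 0 = 0 := by simp [hy, h0, yCoord_one]
  have dφ := fun t => (hg t).1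
  have dx := fun t => (hg t).2.1
  have dy := fun t => (hg t).2.2
  obtain ⟨θ, hθ0, hθ, hs, hc⟩ := exists_angle (α := α)
    (u := fun t => Real.cos α - y t * Real.sin α - β * x t)
    (v := fun t => Real.sin α * Real.cosh (φ t) + β * Real.sinh (φ t))
    (h := fun t => Real.sin α * Real.sinh (φ t) + β * Real.cosh (φ t))
    (by
      have : Continuous φ := continuous_iff_continuousAt.2 fun t => (dφ t).continuousAt
      fun_prop)
    (fun t => ((((dy t).mul_const _).const_sub _).sub ((dx t).const_mul β)).congr_deriv (by ring))
    (fun t => (((dφ t).cosh.const_mul _).add ((dφ t).sinh.const_mul β)).congr_deriv (by ring))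
    (by simp [hx0, hy0]) (by simp [hφ0])
  have hγ : ∀ t, HasDerivAt (fun t => 2 * θ t)
      (-2 * (Real.sin α * Real.sinh (φ t) + β * Real.cosh (φ t))) t := fun t =>
    ((hθ t).const_mul 2).congr_deriv (by ring)
  have hγ' : deriv (fun t => 2 * θ t) =
      fun t => -2 * (Real.sin α * Real.sinh (φ t) + β * Real.cosh (φ t)) :=
    funext fun t => (hγ t).deriv
  have half : ∀ t, 2 * θ t / 2 = θ t := fun t => by ring
  refine ⟨φ, x, y, fun t => 2 * θ t, fun t => toMat_eq _, hφ0, hx0, hy0, ?_, ?_, ?_, ?_, ?_,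
    fun t => (hγ t).differentiableAt, fun t => ?_, ?_, ?_⟩
  · simpa only [half] using hc
  · simpa only [half] using hs
  · simpa only [half, hs] using dφ
  · simpa only [half, hc] using dx
  · simpa only [half, hc] using dy
  · rw [hγ', Real.sin_two_mul, hs, hc]
    exact ((((dφ t).sinh.const_mul _).add ((dφ t).cosh.const_mul β)).const_mul (-2)).congr_deriv
      (by ring)
  · simp only [hθ0]; ring
  · simp [hγ', hφ0]

/-! ### Velocities, controls and speed of curves -/

theorem toMat_inv_mul (g : SH2) : toMat g⁻¹ * toMat g = 1 := by
  rw [← toMat_one, ← inv_mul_cancel g]; rfl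

theorem toMat_mul_inv (g : SH2) : toMat g * toMat g⁻¹ = 1 := by
  rw [← toMat_one, ← mul_inv_cancel g]; rfl

theorem bodyVelocity_eq {c : ℝ → SH2} {t a b : ℝ}
    (h : ∀ i j, HasDerivAt (fun s => toMat (c s) i j) ((toMat (c t) * (a • e₁ + b • e₂)) i j) t) :
    bodyVelocity c t = a • e₁ + b • e₂ := by
  have : velocity c t = toMat (c t) * (a • e₁ + b • e₂) := by
    ext i j; simpa [velocity] using (h i j).deriv
  rw [bodyVelocity, this, ← Matrix.mul_assoc, toMat_inv_mul, Matrix.one_mul]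

theorem bodyVelocity_congr {c c' : ℝ → SH2} {t : ℝ} (h : c =ᶠ[nhds t] c') :
    bodyVelocity c t = bodyVelocity c' t := by
  have : velocity c t = velocity c' t := by
    ext i j
    exact Filter.EventuallyEq.deriv_eq (h.mono fun s hs => by simp only [hs])
  rw [bodyVelocity, bodyVelocity, this, h.eq_of_nhds]

theorem bodyVelocity_comp_sub (c : ℝ → SH2) (s t : ℝ) :
    bodyVelocity (fun r => c (r - s)) t = bodyVelocity c (t - s) := by
  have : velocity (fun r => c (r - s)) t = velocity c (t - s) := by
    ext i j
    exact deriv_comp_sub_const (fun r => toMat (c r) i j) s t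
  rw [bodyVelocity, bodyVelocity, this]

/-- The first control of a curve, the coefficient of `e₁` in its body velocity. -/
noncomputable def control₁ (c : ℝ → SH2) (t : ℝ) : ℝ := deriv (fun s => rapidity (c s)) t

/-- The second control of a curve, the coefficient of `e₂` in its body velocity. -/
noncomputable def control₂ (c : ℝ → SH2) (t : ℝ) : ℝ :=
  deriv (fun s => xCoord (c s)) t / Real.cosh (rapidity (c t))

/-- The curve `c` is tangent to the distribution at time `t`. -/
structure IsTangentAt (c : ℝ → SH2) (t : ℝ) : Prop where
  rapidity : HasDerivAt (fun s => rapidity (c s)) (control₁ c t) t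
  xCoord : HasDerivAt (fun s => xCoord (c s)) (control₂ c t * Real.cosh (SH2.rapidity (c t))) t
  yCoord : HasDerivAt (fun s => yCoord (c s)) (control₂ c t * Real.sinh (SH2.rapidity (c t))) t

theorem IsTangentAt.bodyVelocity_eq {c : ℝ → SH2} {t : ℝ} (h : IsTangentAt c t) :
    bodyVelocity c t = control₁ c t • e₁ + control₂ c t • e₂ :=
  SH2.bodyVelocity_eq (hasDerivAt_toMat h.rapidity h.xCoord h.yCoord)

theorem isTangentAt_of_mem_horizontal {c : ℝ → SH2} {t : ℝ}
    (hd : ∀ i j, DifferentiableAt ℝ (fun s => toMat (c s) i j) t)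
    (hb : bodyVelocity c t ∈ horizontal) : IsTangentAt c t := by
  obtain ⟨a, b, hab⟩ := Submodule.mem_span_pair.1 hb
  have hv : velocity c t = toMat (c t) * (a • e₁ + b • e₂) := by
    rw [hab, bodyVelocity, ← Matrix.mul_assoc, toMat_mul_inv, Matrix.one_mul]
  obtain ⟨h1, h2, h3⟩ := hasDerivAt_coords (g := c) (t := t) (a := a) (b := b) fun i j => by
    rw [← hv]; exact (hd i j).hasDerivAt
  have ha : control₁ c t = a := h1.deriv
  have hb : control₂ c t = b := by
    rw [control₂, h2.deriv, mul_div_cancel_right₀ _ (Real.cosh_pos _).ne']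
  exact ⟨by rwa [ha], by rwa [hb], by rwa [hb]⟩

/-- The speed of a curve. -/
noncomputable def speed (c : ℝ → SH2) (t : ℝ) : ℝ :=
  Real.sqrt (ip (bodyVelocity c t) (bodyVelocity c t))

theorem pathLength_eq (c : ℝ → SH2) (T : ℝ) : pathLength c T = ∫ t in (0 : ℝ)..T, speed c t := rfl

theorem speed_nonneg (c : ℝ → SH2) (t : ℝ) : 0 ≤ speed c t := Real.sqrt_nonneg _

theorem ip_horizontal (a b a' b' : ℝ) :
    ip (a • e₁ + b • e₂) (a' • e₁ + b' • e₂) = a * a' + b * b' := by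
  simp [ip, e₁, e₂]

theorem IsTangentAt.speed_eq {c : ℝ → SH2} {t : ℝ} (h : IsTangentAt c t) :
    speed c t = Real.sqrt (control₁ c t ^ 2 + control₂ c t ^ 2) := by
  rw [speed, h.bodyVelocity_eq, ip_horizontal, sq, sq]

theorem contDiffOn_coords {c : ℝ → SH2} {s : Set ℝ}
    (h : ∀ i j, ContDiffOn ℝ ∞ (fun t => toMat (c t) i j) s) :
    ContDiffOn ℝ ∞ (fun t => rapidity (c t)) s ∧ ContDiffOn ℝ ∞ (fun t => xCoord (c t)) s ∧
      ContDiffOn ℝ ∞ (fun t => yCoord (c t)) s :=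
  ⟨(h 1 0).arsinh, h 0 2, h 1 2⟩

/-- At the ends of a smooth piece only one-sided derivatives are meaningful, and `deriv` may be
discontinuous there. The derivative within the closed interval is a continuous representative, which
suffices for integrability. -/
theorem exists_continuousOn_eqOn_deriv {f : ℝ → ℝ} {a b : ℝ} (hab : a < b)
    (hf : ContDiffOn ℝ ∞ f (Set.Icc a b)) :
    ∃ f', ContinuousOn f' (Set.Icc a b) ∧ Set.EqOn f' (deriv f) (Set.Ioo a b) :=
  ⟨derivWithin f (Set.Icc a b),
    hf.continuousOn_derivWithin (uniqueDiffOn_Icc hab) (by simp),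
    fun t ht => derivWithin_of_mem_nhds (Icc_mem_nhds ht.1 ht.2)⟩

/-! ### Regularity of piecewise smooth horizontal paths -/

/-- The properties of piecewise smooth horizontal paths that are used below: they are continuous,
tangent to the distribution off a countable set, and have integrable controls. -/
structure IsAdmissible (c : ℝ → SH2) (T : ℝ) : Prop where
  nonneg : 0 ≤ T
  continuousOn_rapidity : ContinuousOn (fun t => SH2.rapidity (c t)) (Set.Icc 0 T)
  continuousOn_xCoord : ContinuousOn (fun t => SH2.xCoord (c t)) (Set.Icc 0 T)
  continuousOn_yCoord : ContinuousOn (fun t => SH2.yCoord (c t)) (Set.Icc 0 T)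
  integrable₁ : IntervalIntegrable (control₁ c) MeasureTheory.volume 0 T
  integrable₂ : IntervalIntegrable (control₂ c) MeasureTheory.volume 0 T
  integrable_speed : IntervalIntegrable (speed c) MeasureTheory.volume 0 T
  tangent : ∃ S : Set ℝ, S.Countable ∧ ∀ t ∈ Set.Ioo 0 T \ S, IsTangentAt c t

theorem continuousOn_iterate {f : ℝ → ℝ} {τ : ℕ → ℝ} (hτ : Monotone τ) (n : ℕ)
    (h : ∀ k < n, ContinuousOn f (Set.Icc (τ k) (τ (k + 1)))) :
    ContinuousOn f (Set.Icc (τ 0) (τ n)) := by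
  induction n with
  | zero => simp
  | succ n ih =>
    rw [← Set.Icc_union_Icc_eq_Icc (hτ (Nat.zero_le n)) (hτ n.le_succ)]
    exact (ih fun k hk => h k (by omega)).union_of_isClosed (h n (by omega)) isClosed_Icc
      isClosed_Icc

theorem exists_mem_Ioo {τ : ℕ → ℝ} {t : ℝ} (ht : t ∉ Set.range τ) (n : ℕ)
    (h : t ∈ Set.Ioo (τ 0) (τ n)) : ∃ k < n, t ∈ Set.Ioo (τ k) (τ (k + 1)) := by
  induction n with
  | zero => exact absurd (h.1.trans h.2) (lt_irrefl _)
  | succ n ih =>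
    rcases lt_trichotomy t (τ n) with h' | h' | h'
    · obtain ⟨k, hk, hk'⟩ := ih ⟨h.1, h'⟩
      exact ⟨k, by omega, hk'⟩
    · exact absurd ⟨n, h'.symm⟩ ht
    · exact ⟨n, by omega, h', h.2⟩

theorem IsHorizontalPath.isAdmissible {c : ℝ → SH2} {T : ℝ} (h : IsHorizontalPath c T) :
    IsAdmissible c T := by
  obtain ⟨n, τ, hτ, h0, hn, h⟩ := h
  have htan : ∀ k < n, ∀ t ∈ Set.Ioo (τ k) (τ (k + 1)), IsTangentAt c t := fun k hk t ht =>
    isTangentAt_of_mem_horizontal (fun i j =>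
      (((h k hk).1 i j).contDiffAt (Icc_mem_nhds ht.1 ht.2)).differentiableAt (by simp))
      ((h k hk).2 t ht)
  have hcont : ∀ k < n, _ := fun k hk => contDiffOn_coords (h k hk).1
  have hctrl : ∀ k < n, τ k < τ (k + 1) → ∃ u₁ u₂ : ℝ → ℝ,
      ContinuousOn u₁ (Set.Icc (τ k) (τ (k + 1))) ∧ ContinuousOn u₂ (Set.Icc (τ k) (τ (k + 1))) ∧
      Set.EqOn u₁ (control₁ c) (Set.Ioo (τ k) (τ (k + 1))) ∧
      Set.EqOn u₂ (control₂ c) (Set.Ioo (τ k) (τ (k + 1))) := by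
    intro k hk hlt
    obtain ⟨f, hf, hf'⟩ := exists_continuousOn_eqOn_deriv hlt (hcont k hk).1
    obtain ⟨f₂, hf₂, hf₂'⟩ := exists_continuousOn_eqOn_deriv hlt (hcont k hk).2.1
    exact ⟨f, fun t => f₂ t / Real.cosh (rapidity (c t)), hf,
      hf₂.div (Real.continuous_cosh.comp_continuousOn (hcont k hk).1.continuousOn)
        (fun t _ => (Real.cosh_pos _).ne'), hf', fun t ht => by
          simp only [control₂]; rw [hf₂' ht]⟩
  have hint : ∀ f : ℝ → ℝ, (∀ k < n, τ k < τ (k + 1) → ∃ f',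
      ContinuousOn f' (Set.Icc (τ k) (τ (k + 1))) ∧ Set.EqOn f' f (Set.Ioo (τ k) (τ (k + 1)))) →
      IntervalIntegrable f MeasureTheory.volume 0 T := by
    intro f hf
    rw [← h0, ← hn]
    refine IntervalIntegrable.trans_iterate fun k hk => ?_
    -- The partition may have repeated nodes; the degenerate pieces are trivial.
    rcases (hτ k.le_succ).eq_or_lt with e | hlt
    · rw [e]
    · obtain ⟨f', hc, he⟩ := hf k hk hlt
      exact (hc.intervalIntegrable_of_Icc hlt.le).congr_uIoo (by rwa [Set.uIoo_of_le hlt.le])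
  refine ⟨?_, ?_, ?_, ?_, ?_, ?_, ?_, Set.range τ, Set.countable_range τ, ?_⟩
  · rw [← h0, ← hn]; exact hτ (Nat.zero_le n)
  · rw [← h0, ← hn]
    exact continuousOn_iterate hτ n fun k hk => (hcont k hk).1.continuousOn
  · rw [← h0, ← hn]
    exact continuousOn_iterate hτ n fun k hk => (hcont k hk).2.1.continuousOn
  · rw [← h0, ← hn]
    exact continuousOn_iterate hτ n fun k hk => (hcont k hk).2.2.continuousOn
  · refine hint _ fun k hk hlt => ?_
    obtain ⟨u₁, u₂, h1, h2, h3, h4⟩ := hctrl k hk hlt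
    exact ⟨u₁, h1, h3⟩
  · refine hint _ fun k hk hlt => ?_
    obtain ⟨u₁, u₂, h1, h2, h3, h4⟩ := hctrl k hk hlt
    exact ⟨u₂, h2, h4⟩
  · refine hint _ fun k hk hlt => ?_
    obtain ⟨u₁, u₂, h1, h2, h3, h4⟩ := hctrl k hk hlt
    refine ⟨fun t => Real.sqrt (u₁ t ^ 2 + u₂ t ^ 2), ((h1.pow 2).add (h2.pow 2)).sqrt, ?_⟩
    intro t ht
    simp only [(htan k hk t ht).speed_eq, h3 ht, h4 ht]
  · rintro t ⟨ht, ht'⟩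
    rw [← h0, ← hn] at ht
    obtain ⟨k, hk, hk'⟩ := exists_mem_Ioo ht' n ht
    exact htan k hk t hk'

/-! ### Displacement is bounded by length and by distance -/

/-- The fundamental theorem of calculus tolerates a countable exceptional set, here the nodes of the
partition, and such a set is null for the integral bound. -/
theorem abs_sub_le_of_hasDerivAt_le {f f' s : ℝ → ℝ} {a b : ℝ} {S : Set ℝ}
    (hab : a ≤ b) (hS : S.Countable)
    (hc : ContinuousOn f (Set.Icc a b)) (hd : ∀ t ∈ Set.Ioo a b \ S, HasDerivAt f (f' t) t)
    (hi : IntervalIntegrable f' MeasureTheory.volume a b)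
    (hs : IntervalIntegrable s MeasureTheory.volume a b)
    (hle : ∀ t ∈ Set.Ioo a b \ S, |f' t| ≤ s t) : |f b - f a| ≤ ∫ t in a..b, s t := by
  rw [← MeasureTheory.integral_eq_of_hasDerivAt_off_countable_of_le f f' hab hS hc hd hi,
    ← Real.norm_eq_abs]
  refine intervalIntegral.norm_integral_le_of_norm_le hab ?_ hs
  have h1 : ∀ᵐ t : ℝ, t ∉ S := by
    rw [MeasureTheory.ae_iff]; simpa using hS.measure_zero _
  have h2 : ∀ᵐ t : ℝ, t ≠ b := by
    rw [MeasureTheory.ae_iff]; simp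
  filter_upwards [h1, h2] with t ht ht' htm
  exact hle t ⟨⟨htm.1, lt_of_le_of_ne htm.2 ht'⟩, ht⟩

namespace IsAdmissible

variable {c : ℝ → SH2} {T : ℝ}

theorem pathLength_nonneg (h : IsAdmissible c T) : 0 ≤ pathLength c T :=
  intervalIntegral.integral_nonneg h.nonneg fun t _ => speed_nonneg c t

theorem abs_rapidity_sub_le (h : IsAdmissible c T) {t : ℝ} (ht : t ∈ Set.Icc 0 T) :
    |rapidity (c t) - rapidity (c 0)| ≤ pathLength c T := by
  obtain ⟨S, hS, htan⟩ := h.tangent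
  have hsub : Set.uIcc 0 t ⊆ Set.uIcc 0 T := by
    rw [Set.uIcc_of_le ht.1, Set.uIcc_of_le h.nonneg]; exact Set.Icc_subset_Icc le_rfl ht.2
  refine (abs_sub_le_of_hasDerivAt_le (f := fun t => rapidity (c t)) ht.1 hS
    (h.continuousOn_rapidity.mono (Set.Icc_subset_Icc le_rfl ht.2))
    (fun s hs => (htan s ⟨⟨hs.1.1, hs.1.2.trans_le ht.2⟩, hs.2⟩).rapidity)
    (h.integrable₁.mono_set hsub) (h.integrable_speed.mono_set hsub) fun s hs => ?_).trans ?_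
  · rw [(htan s ⟨⟨hs.1.1, hs.1.2.trans_le ht.2⟩, hs.2⟩).speed_eq]
    exact Real.abs_le_sqrt (by nlinarith [sq_nonneg (control₂ c s)])
  · exact intervalIntegral.integral_mono_interval le_rfl ht.1 ht.2
      (Filter.Eventually.of_forall fun s => speed_nonneg c s) h.integrable_speed

/-- The displacement along a horizontal path, in the coordinates centred at its initial point, is
controlled by the length of the path. -/
theorem displacement_le (h : IsAdmissible c T) :
    (∀ a b : ℝ, a ^ 2 + b ^ 2 = 1 → |a * (rapidity (c T) - rapidity (c 0)) +
      b * (Real.cosh (rapidity (c 0)) * (xCoord (c T) - xCoord (c 0)) -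
        Real.sinh (rapidity (c 0)) * (yCoord (c T) - yCoord (c 0)))| ≤
      pathLength c T * Real.cosh (pathLength c T)) ∧
    |Real.cosh (rapidity (c 0)) * (yCoord (c T) - yCoord (c 0)) -
        Real.sinh (rapidity (c 0)) * (xCoord (c T) - xCoord (c 0))| ≤
      pathLength c T * Real.sinh (pathLength c T) := by
  obtain ⟨S, hS, htan⟩ := h.tangent
  have hcs : ∀ t ∈ Set.Icc 0 T, Real.cosh (rapidity (c t) - rapidity (c 0)) ≤
      Real.cosh (pathLength c T) := fun t ht => by
    rw [Real.cosh_le_cosh, abs_of_nonneg h.pathLength_nonneg]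
    exact h.abs_rapidity_sub_le ht
  have hsn : ∀ t ∈ Set.Icc 0 T, |Real.sinh (rapidity (c t) - rapidity (c 0))| ≤
      Real.sinh (pathLength c T) := fun t ht => by
    rw [Real.abs_sinh, Real.sinh_le_sinh]
    exact h.abs_rapidity_sub_le ht
  have hc₁ := h.continuousOn_rapidity
  have hc₂ := h.continuousOn_xCoord
  have hc₃ := h.continuousOn_yCoord
  have hcosh : ContinuousOn (fun t => Real.cosh (rapidity (c t) - rapidity (c 0)))
      (Set.uIcc 0 T) := by
    rw [Set.uIcc_of_le h.nonneg]; fun_prop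
  have hsinh : ContinuousOn (fun t => Real.sinh (rapidity (c t) - rapidity (c 0)))
      (Set.uIcc 0 T) := by
    rw [Set.uIcc_of_le h.nonneg]; fun_prop
  refine ⟨fun a b hab => ?_, ?_⟩
  -- Undoing the initial boost leaves the derivatives u₂ cosh(φ - φ₀) and u₂ sinh(φ - φ₀) of the
  -- translation part, where |φ - φ₀| is at most the length.
  · have := abs_sub_le_of_hasDerivAt_le (f := fun t => a * (rapidity (c t) - rapidity (c 0)) +
      b * (Real.cosh (rapidity (c 0)) * (xCoord (c t) - xCoord (c 0)) -
        Real.sinh (rapidity (c 0)) * (yCoord (c t) - yCoord (c 0))))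
      (f' := fun t => a * control₁ c t +
        b * (control₂ c t * Real.cosh (rapidity (c t) - rapidity (c 0))))
      (s := fun t => speed c t * Real.cosh (pathLength c T)) h.nonneg hS (by fun_prop)
      (fun t ht => by
        have := htan t ht
        refine (((this.rapidity.sub_const _).const_mul a).add
          ((((this.xCoord.sub_const _).const_mul _).sub
            ((this.yCoord.sub_const _).const_mul _)).const_mul b)).congr_deriv ?_
        rw [Real.cosh_sub]; ring)
      ((h.integrable₁.const_mul a).add ((h.integrable₂.mul_continuousOn hcosh).const_mul b))
      (h.integrable_speed.mul_const _)
      (fun t ht => by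
        rw [(htan t ht).speed_eq]
        set C := Real.cosh (rapidity (c t) - rapidity (c 0))
        have h1 : 1 ≤ C := Real.one_le_cosh _
        have h2 : C ≤ Real.cosh (pathLength c T) := hcs t ⟨ht.1.1.le, ht.1.2.le⟩
        set u := control₁ c t
        set v := control₂ c t
        -- Cauchy-Schwarz for the unit vector (a, b), and then 1 ≤ C to absorb u² into C²u².
        have h3 : |a * u + b * (v * C)| ≤ Real.sqrt (u ^ 2 + v ^ 2) * C := by
          rw [← Real.sqrt_sq (zero_le_one.trans h1), ← Real.sqrt_mul (by positivity)]
          apply Real.abs_le_sqrt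
          rw [Real.sqrt_sq (zero_le_one.trans h1)]
          have h4 : (a * u + b * (v * C)) ^ 2 ≤ (a ^ 2 + b ^ 2) * (u ^ 2 + (v * C) ^ 2) := by
            nlinarith [sq_nonneg (a * (v * C) - b * u)]
          rw [hab, one_mul] at h4
          have h5 : u ^ 2 * 1 ≤ u ^ 2 * C ^ 2 :=
            mul_le_mul_of_nonneg_left (by nlinarith) (sq_nonneg u)
          nlinarith
        exact h3.trans (mul_le_mul_of_nonneg_left h2 (Real.sqrt_nonneg _)))
    rw [intervalIntegral.integral_mul_const] at this
    simpa [pathLength_eq] using this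
  · have := abs_sub_le_of_hasDerivAt_le
      (f := fun t => Real.cosh (rapidity (c 0)) * (yCoord (c t) - yCoord (c 0)) -
        Real.sinh (rapidity (c 0)) * (xCoord (c t) - xCoord (c 0)))
      (f' := fun t => control₂ c t * Real.sinh (rapidity (c t) - rapidity (c 0)))
      (s := fun t => speed c t * Real.sinh (pathLength c T)) h.nonneg hS (by fun_prop)
      (fun t ht => by
        have := htan t ht
        refine ((((this.yCoord.sub_const _).const_mul _).sub
            ((this.xCoord.sub_const _).const_mul _))).congr_deriv ?_
        rw [Real.sinh_sub]; ring)
      (h.integrable₂.mul_continuousOn hsinh)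
      (h.integrable_speed.mul_const _)
      (fun t ht => by
        rw [(htan t ht).speed_eq, abs_mul]
        exact mul_le_mul (Real.abs_le_sqrt (by nlinarith [sq_nonneg (control₁ c t)]))
          (hsn t ⟨ht.1.1.le, ht.1.2.le⟩) (abs_nonneg _) (Real.sqrt_nonneg _))
    rw [intervalIntegral.integral_mul_const] at this
    simpa [pathLength_eq] using this

end IsAdmissible

theorem exists_path_of_sRdist_lt {p q : SH2} {ℓ : ℝ} (h : sRdist p q < ENNReal.ofReal ℓ) :
    ∃ c T, IsHorizontalPath c T ∧ c 0 = p ∧ c T = q ∧ pathLength c T < ℓ := by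
  simp only [sRdist, iInf_lt_iff] at h
  obtain ⟨c, T, ⟨h1, h2, h3⟩, h4⟩ := h
  exact ⟨c, T, h1, h2, h3, ENNReal.ofReal_lt_ofReal_iff'.1 h4 |>.1⟩

theorem sRdist_le_pathLength {c : ℝ → SH2} {T : ℝ} (h : IsHorizontalPath c T) :
    sRdist (c 0) (c T) ≤ ENNReal.ofReal (pathLength c T) :=
  (iInf_le _ c).trans ((iInf_le _ T).trans (iInf_le _ ⟨h, rfl, rfl⟩))

/-- The infimum need not be attained, so the bounds are proved for every m > ℓ and pass to the limit
by continuity. The last bound is of second order in ℓ, which will force tangency to the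
distribution; the middle one is ℓ up to higher order in every direction, which will force speed at
most 1. -/
theorem displacement_le_of_sRdist_le {p q : SH2} {ℓ : ℝ} (hℓ : 0 ≤ ℓ)
    (h : sRdist p q ≤ ENNReal.ofReal ℓ) :
    |rapidity q - rapidity p| ≤ ℓ ∧
    (∀ a b : ℝ, a ^ 2 + b ^ 2 = 1 → |a * (rapidity q - rapidity p) +
      b * (Real.cosh (rapidity p) * (xCoord q - xCoord p) -
        Real.sinh (rapidity p) * (yCoord q - yCoord p))| ≤ ℓ * Real.cosh ℓ) ∧
    |Real.cosh (rapidity p) * (yCoord q - yCoord p) -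
        Real.sinh (rapidity p) * (xCoord q - xCoord p)| ≤ ℓ * Real.sinh ℓ := by
  have key : ∀ m > ℓ, |rapidity q - rapidity p| ≤ m ∧
    (∀ a b : ℝ, a ^ 2 + b ^ 2 = 1 → |a * (rapidity q - rapidity p) +
      b * (Real.cosh (rapidity p) * (xCoord q - xCoord p) -
        Real.sinh (rapidity p) * (yCoord q - yCoord p))| ≤ m * Real.cosh m) ∧
    |Real.cosh (rapidity p) * (yCoord q - yCoord p) -
        Real.sinh (rapidity p) * (xCoord q - xCoord p)| ≤ m * Real.sinh m := by
    intro m hm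
    obtain ⟨c, T, hc, rfl, rfl, hlt⟩ := exists_path_of_sRdist_lt
      (h.trans_lt ((ENNReal.ofReal_lt_ofReal_iff (hℓ.trans_lt hm)).2 hm))
    have hA := hc.isAdmissible
    have hd := hA.displacement_le
    have hl := hA.pathLength_nonneg
    have hm0 : 0 ≤ m := hℓ.trans hm.le
    refine ⟨(hA.abs_rapidity_sub_le ⟨hA.nonneg, le_rfl⟩).trans hlt.le, fun a b hab =>
      (hd.1 a b hab).trans ?_, hd.2.trans ?_⟩
    · exact mul_le_mul hlt.le
        (Real.cosh_le_cosh.2 (by rw [abs_of_nonneg hl, abs_of_nonneg hm0]; exact hlt.le))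
        (Real.cosh_pos _).le hm0
    · exact mul_le_mul hlt.le (Real.sinh_le_sinh.2 hlt.le) (Real.sinh_nonneg_iff.2 hl) hm0
  have hlim : ∀ {f : ℝ → ℝ} {r : ℝ}, Continuous f → (∀ m > ℓ, r ≤ f m) → r ≤ f ℓ :=
    fun hf hr => ge_of_tendsto ((hf.tendsto ℓ).mono_left nhdsWithin_le_nhds)
      (Filter.eventually_of_mem (self_mem_nhdsWithin (s := Set.Ioi ℓ)) hr)
  exact ⟨hlim continuous_id fun m hm => (key m hm).1,
    fun a b hab => hlim (by fun_prop) fun m hm => (key m hm).2.1 a b hab,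
    hlim (by fun_prop) fun m hm => (key m hm).2.2⟩

/-! ### Concatenation and the triangle inequality -/

/-- No smoothness is needed at the junction, which becomes a node of the partition; the velocity
there does not affect the length. -/
theorem IsHorizontalPath.append {c₁ c₂ : ℝ → SH2} {T₁ T₂ : ℝ} (h₁ : IsHorizontalPath c₁ T₁)
    (h₂ : IsHorizontalPath c₂ T₂) (h : c₁ T₁ = c₂ 0) :
    ∃ c, IsHorizontalPath c (T₁ + T₂) ∧ c 0 = c₁ 0 ∧ c (T₁ + T₂) = c₂ T₂ ∧
      pathLength c (T₁ + T₂) = pathLength c₁ T₁ + pathLength c₂ T₂ := by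
  have hA₁ := h₁.isAdmissible
  have hA₂ := h₂.isAdmissible
  have hT₁ := hA₁.nonneg
  have hT₂ := hA₂.nonneg
  set c : ℝ → SH2 := fun t => if t ≤ T₁ then c₁ t else c₂ (t - T₁) with hc
  have hl : Set.EqOn c c₁ (Set.Iic T₁) := fun t ht => if_pos ht
  have hr : Set.EqOn c (fun t => c₂ (t - T₁)) (Set.Ici T₁) := fun t ht => by
    rcases (Set.mem_Ici.1 ht).eq_or_lt with rfl | hlt
    · simp [hc, h]
    · exact if_neg hlt.not_ge
  have hbl : ∀ t < T₁, bodyVelocity c t = bodyVelocity c₁ t := fun t ht =>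
    bodyVelocity_congr (hl.eventuallyEq_of_mem (Iic_mem_nhds ht))
  have hbr : ∀ t > T₁, bodyVelocity c t = bodyVelocity c₂ (t - T₁) := fun t ht => by
    rw [bodyVelocity_congr (hr.eventuallyEq_of_mem (Ici_mem_nhds ht)), bodyVelocity_comp_sub]
  refine ⟨c, ?_, hl hT₁, ?_, ?_⟩
  · obtain ⟨n₁, τ₁, hm₁, h01, hn₁, hp₁⟩ := h₁
    obtain ⟨n₂, τ₂, hm₂, h02, hn₂, hp₂⟩ := h₂
    -- The two branches agree at k = n₁, since τ₁ n₁ = T₁ and τ₂ 0 = 0.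
    have hsub : ∀ k, n₁ ≤ k → (if k ≤ n₁ then τ₁ k else T₁ + τ₂ (k - n₁)) = T₁ + τ₂ (k - n₁) := by
      intro k hk
      rcases hk.eq_or_lt with rfl | hlt
      · simp [hn₁, h02]
      · exact if_neg hlt.not_ge
    refine ⟨n₁ + n₂, fun k => if k ≤ n₁ then τ₁ k else T₁ + τ₂ (k - n₁), ?_, ?_, ?_, ?_⟩
    · refine monotone_nat_of_le_succ fun k => ?_
      rcases lt_or_ge k n₁ with hk | hk
      · simp only [if_pos hk.le, if_pos (Nat.succ_le_of_lt hk)]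
        exact hm₁ k.le_succ
      · simp only [hsub k hk, hsub (k + 1) (by omega)]
        gcongr
        exact hm₂ (by omega)
    · simp [h01]
    · exact (hsub _ (Nat.le_add_right n₁ n₂)).trans (by simp [hn₂])
    · intro k hk
      rcases lt_or_ge k n₁ with hk' | hk'
      · simp only [if_pos hk'.le, if_pos (Nat.succ_le_of_lt hk')]
        have hle : τ₁ (k + 1) ≤ T₁ := hn₁ ▸ hm₁ (Nat.succ_le_of_lt hk')
        refine ⟨fun i j => ((hp₁ k hk').1 i j).congr fun t ht => ?_, fun t ht => ?_⟩
        · rw [hl (ht.2.trans hle)]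
        · rw [hbl t (ht.2.trans_le hle)]; exact (hp₁ k hk').2 t ht
      · simp only [hsub k hk', hsub (k + 1) (by omega)]
        rw [show k + 1 - n₁ = k - n₁ + 1 by omega]
        have hle : 0 ≤ τ₂ (k - n₁) := h02 ▸ hm₂ (Nat.zero_le _)
        obtain ⟨hp, hp'⟩ := hp₂ (k - n₁) (by omega)
        refine ⟨fun i j => ?_, fun t ht => ?_⟩
        · have := (hp i j).comp (g := fun t => toMat (c₂ t) i j) (f := fun t => t - T₁)
            (s := Set.Icc (T₁ + τ₂ (k - n₁)) (T₁ + τ₂ (k - n₁ + 1)))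
            (contDiff_id.sub contDiff_const).contDiffOn
            (fun t ht => ⟨by linarith [ht.1], by linarith [ht.2]⟩)
          refine this.congr fun t ht => ?_
          rw [hr (Set.mem_Ici.2 (by linarith [ht.1]))]
          rfl
        · rw [hbr t (by linarith [ht.1])]
          exact hp' _ ⟨by linarith [ht.1], by linarith [ht.2]⟩
  · rw [hr (Set.mem_Ici.2 (by linarith))]; simp
  · have e₁ : Set.EqOn (speed c₁) (speed c) (Set.Ioo 0 T₁) := fun t ht => by
      simp only [speed, hbl t ht.2]
    have e₂ : Set.EqOn (fun t => speed c₂ (t - T₁)) (speed c) (Set.Ioo T₁ (T₁ + T₂)) :=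
      fun t ht => by simp only [speed, hbr t ht.1]
    have i₁ := hA₁.integrable_speed.congr_uIoo (by rwa [Set.uIoo_of_le hT₁])
    have i₂ : IntervalIntegrable (speed c) MeasureTheory.volume T₁ (T₁ + T₂) := by
      have := hA₂.integrable_speed.comp_sub_right T₁
      rw [zero_add, add_comm T₂] at this
      exact this.congr_uIoo (by rwa [Set.uIoo_of_le (by linarith)])
    rw [pathLength_eq, pathLength_eq, pathLength_eq,
      ← intervalIntegral.integral_add_adjacent_intervals i₁ i₂,
      intervalIntegral.integral_congr_Ioo_of_le hT₁ e₁,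
      ← intervalIntegral.integral_congr_Ioo_of_le (by linarith) e₂,
      intervalIntegral.integral_comp_sub_right]
    simp

theorem sRdist_triangle (p q r : SH2) : sRdist p r ≤ sRdist p q + sRdist q r := by
  conv_rhs => rw [sRdist, sRdist]
  simp only [ENNReal.iInf_add, ENNReal.add_iInf]
  refine le_iInf fun c₂ => le_iInf fun T₂ => le_iInf fun ⟨h₂, h₂q, h₂r⟩ => le_iInf fun c₁ =>
    le_iInf fun T₁ => le_iInf fun ⟨h₁, h₁p, h₁q⟩ => ?_
  obtain ⟨c, hc, hc0, hcT, hlen⟩ := h₁.append h₂ (h₁q.trans h₂q.symm)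
  rw [← ENNReal.ofReal_add h₁.isAdmissible.pathLength_nonneg h₂.isAdmissible.pathLength_nonneg,
    ← hlen, ← h₁p, ← h₂r, ← hc0, ← hcT]
  exact sRdist_le_pathLength hc

/-! ### Upper bounds for the distance from explicit paths -/

theorem hasDerivAt_integral_of_continuous {f : ℝ → ℝ} (hf : Continuous f) (a t : ℝ) :
    HasDerivAt (fun t => ∫ s in a..t, f s) (f t) t :=
  intervalIntegral.integral_hasDerivAt_right (hf.intervalIntegrable _ _)
    hf.stronglyMeasurable.stronglyMeasurableAtFilter hf.continuousAt

theorem contDiff_integral {f : ℝ → ℝ} (hf : ContDiff ℝ ∞ f) (a : ℝ) :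
    ContDiff ℝ ∞ fun t => ∫ s in a..t, f s := by
  have h := hasDerivAt_integral_of_continuous hf.continuous a
  refine contDiff_infty_iff_deriv.2 ⟨fun t => (h t).differentiableAt, ?_⟩
  rwa [show deriv (fun t => ∫ s in a..t, f s) = f from funext fun t => (h t).deriv]

/-- The end point of a path with constant controls is not further away than the length of the
path. -/
theorem sRdist_le_of_const_control (φ x y v w : ℝ) {T : ℝ} (hT : 0 ≤ T) :
    sRdist (ofCoords φ x y) (ofCoords (φ + v * T) (x + ∫ s in (0 : ℝ)..T, w * Real.cosh (φ + v * s))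
      (y + ∫ s in (0 : ℝ)..T, w * Real.sinh (φ + v * s))) ≤
      ENNReal.ofReal (T * Real.sqrt (v ^ 2 + w ^ 2)) := by
  set c : ℝ → SH2 := fun t => ofCoords (φ + v * t)
      (x + ∫ s in (0 : ℝ)..t, w * Real.cosh (φ + v * s))
      (y + ∫ s in (0 : ℝ)..t, w * Real.sinh (φ + v * s)) with hc
  have hb : ∀ t, bodyVelocity c t = v • e₁ + w • e₂ := fun t => by
    refine bodyVelocity_eq (hasDerivAt_toMat ?_ ?_ ?_)
    · simpa [hc] using ((hasDerivAt_id t).const_mul v).const_add φ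
    · simpa [hc] using
        (hasDerivAt_integral_of_continuous (f := fun s => w * Real.cosh (φ + v * s))
          (by fun_prop) 0 t)
    · simpa [hc] using
        (hasDerivAt_integral_of_continuous (f := fun s => w * Real.sinh (φ + v * s))
          (by fun_prop) 0 t)
  have hφ : ContDiff ℝ ∞ fun t => φ + v * t := by fun_prop
  have hcosh := Real.contDiff_cosh.comp hφ
  have hsinh := Real.contDiff_sinh.comp hφ
  have hx := (contDiff_const (c := x)).add
    ((contDiff_const (c := w)).mul (contDiff_integral hcosh 0))
  have hy := (contDiff_const (c := y)).add
    ((contDiff_const (c := w)).mul (contDiff_integral hsinh 0))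
  have hp : IsHorizontalPath c T := by
    refine ⟨1, fun k => k * T, fun k l h => by dsimp only; gcongr, by simp, by simp, fun k _ =>
      ⟨fun i j => ContDiff.contDiffOn ?_, fun t _ => ?_⟩⟩
    · fin_cases i <;> fin_cases j <;> simp [hc, shMat]
      exacts [hcosh, hsinh, hx, hsinh, hcosh, hy, contDiff_const, contDiff_const, contDiff_const]
    · rw [hb]; exact Submodule.mem_span_pair.2 ⟨v, w, rfl⟩
  have hlen : pathLength c T = T * Real.sqrt (v ^ 2 + w ^ 2) := by
    simp [pathLength, hb, ip_horizontal, sq]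
  have h0 : c 0 = ofCoords φ x y := by simp [hc]
  rw [← hlen, ← h0]
  exact sRdist_le_pathLength hp

theorem sRdist_add_rapidity_le (φ x y r : ℝ) :
    sRdist (ofCoords φ x y) (ofCoords (φ + r) x y) ≤ ENNReal.ofReal |r| := by
  simpa [Real.sqrt_sq_eq_abs] using sRdist_le_of_const_control φ x y r 0 zero_le_one

theorem sRdist_translate_le (φ x y r : ℝ) :
    sRdist (ofCoords φ x y) (ofCoords φ (x + r * Real.cosh φ) (y + r * Real.sinh φ)) ≤
      ENNReal.ofReal |r| := by
  simpa [Real.sqrt_sq_eq_abs] using sRdist_le_of_const_control φ x y 0 r zero_le_one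

/-- The distance between two points with the same hyperbolic angle is small if their coordinates
are close. -/
theorem sRdist_le_of_rapidity_eq (φ x y x' y' : ℝ) {a : ℝ} (ha : 0 < a) :
    sRdist (ofCoords φ x y) (ofCoords φ x' y') ≤ ENNReal.ofReal (4 * a +
      (|x' - x| + |y' - y|) * (2 * Real.cosh (|φ| + a) / Real.sinh (2 * a))) := by
  have hs : 0 < Real.sinh (2 * a) := Real.sinh_pos_iff.2 (by linarith)
  -- The path turns by a, translates by r, turns by -2a, translates by r', and turns by a. Cramer's
  -- rule gives r and r': the directions at the angles φ + a and φ - a are independent, with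
  -- determinant sinh(2a) up to sign.
  set r := ((y' - y) * Real.cosh (φ - a) - (x' - x) * Real.sinh (φ - a)) / Real.sinh (2 * a)
    with hr
  set r' := ((x' - x) * Real.sinh (φ + a) - (y' - y) * Real.cosh (φ + a)) / Real.sinh (2 * a)
    with hr'
  have hdet : Real.sinh (2 * a) =
      Real.sinh (φ + a) * Real.cosh (φ - a) - Real.cosh (φ + a) * Real.sinh (φ - a) := by
    rw [← Real.sinh_sub]; ring_nf
  have ex : x' = x + r * Real.cosh (φ + a) + r' * Real.cosh (φ - a) := by
    rw [hr, hr']; field_simp; rw [mul_comm a 2, hdet]; ring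
  have ey : y' = y + r * Real.sinh (φ + a) + r' * Real.sinh (φ - a) := by
    rw [hr, hr']; field_simp; rw [mul_comm a 2, hdet]; ring
  have d₁ := sRdist_add_rapidity_le φ x y a
  have d₂ := sRdist_translate_le (φ + a) x y r
  have d₃ := sRdist_add_rapidity_le (φ + a) (x + r * Real.cosh (φ + a))
    (y + r * Real.sinh (φ + a)) (-2 * a)
  rw [show φ + a + -2 * a = φ - a by ring] at d₃
  have d₄ := sRdist_translate_le (φ - a) (x + r * Real.cosh (φ + a))
    (y + r * Real.sinh (φ + a)) r'
  rw [← ex, ← ey] at d₄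
  have d₅ := sRdist_add_rapidity_le (φ - a) x' y' a
  rw [sub_add_cancel] at d₅
  have hc : ∀ u : ℝ, |u| ≤ |φ| + a → Real.cosh u ≤ Real.cosh (|φ| + a) ∧
      |Real.sinh u| ≤ Real.cosh (|φ| + a) := fun u hu => by
    have h1 : Real.cosh u ≤ Real.cosh (|φ| + a) :=
      Real.cosh_le_cosh.2 (hu.trans (le_abs_self _))
    refine ⟨h1, le_trans ?_ h1⟩
    rw [← Real.cosh_abs u, Real.abs_sinh]
    exact (Real.sinh_lt_cosh _).le
  have hp := hc (φ + a) ((abs_add_le _ _).trans (by rw [abs_of_pos ha]))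
  have hm := hc (φ - a) ((abs_sub _ _).trans (by rw [abs_of_pos ha]))
  set M := Real.cosh (|φ| + a)
  have bound : ∀ u v, Real.cosh u ≤ M ∧ |Real.sinh u| ≤ M →
      |v| = |(y' - y) * Real.cosh u - (x' - x) * Real.sinh u| / Real.sinh (2 * a) →
      |v| ≤ (|x' - x| + |y' - y|) * (M / Real.sinh (2 * a)) := by
    intro u v hu hv
    rw [hv, ← mul_div_assoc]
    gcongr
    refine (abs_sub _ _).trans ?_
    rw [abs_mul, abs_mul, abs_of_pos (Real.cosh_pos u), add_mul, add_comm]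
    gcongr
    · exact hu.2
    · exact hu.1
  have br := bound (φ - a) r hm (by rw [hr, abs_div, abs_of_pos hs])
  have br' := bound (φ + a) r' hp (by rw [hr', abs_div, abs_of_pos hs, abs_sub_comm])
  have key : sRdist (ofCoords φ x y) (ofCoords φ x' y') ≤ ENNReal.ofReal |a| +
      (ENNReal.ofReal |r| + (ENNReal.ofReal |-2 * a| +
        (ENNReal.ofReal |r'| + ENNReal.ofReal |a|))) :=
    (sRdist_triangle _ _ _).trans (add_le_add d₁ ((sRdist_triangle _ _ _).trans (add_le_add d₂
      ((sRdist_triangle _ _ _).trans (add_le_add d₃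
        ((sRdist_triangle _ _ _).trans (add_le_add d₄ d₅)))))))
  refine key.trans ?_
  rw [← ENNReal.ofReal_add (by positivity) (by positivity),
    ← ENNReal.ofReal_add (by positivity) (by positivity),
    ← ENNReal.ofReal_add (by positivity) (by positivity),
    ← ENNReal.ofReal_add (by positivity) (by positivity)]
  apply ENNReal.ofReal_le_ofReal
  rw [abs_mul, abs_of_pos ha]
  norm_num
  rw [mul_div_assoc]
  linarith

/-! ### Measurable controls and their piecewise constant approximation -/

/-- Measurable functions that are bounded on every bounded interval. -/
structure IsControl (v : ℝ → ℝ) : Prop where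
  measurable : Measurable v
  bounded : ∀ R : ℝ, ∃ K, 0 ≤ K ∧ ∀ t, |t| ≤ R → |v t| ≤ K

namespace IsControl

variable {v w : ℝ → ℝ}

theorem of_continuous (h : Continuous v) : IsControl v := by
  refine ⟨h.measurable, fun R => ?_⟩
  obtain ⟨K, hK⟩ := (isCompact_Icc (a := -R) (b := R)).exists_bound_of_continuousOn h.continuousOn
  exact ⟨max K 0, le_max_right _ _, fun t ht => (hK t (abs_le.1 ht)).trans (le_max_left _ _)⟩

theorem const (a : ℝ) : IsControl fun _ => a := of_continuous continuous_const

theorem add (hv : IsControl v) (hw : IsControl w) : IsControl fun t => v t + w t := by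
  refine ⟨hv.measurable.add hw.measurable, fun R => ?_⟩
  obtain ⟨K, hK0, hK⟩ := hv.bounded R
  obtain ⟨L, hL0, hL⟩ := hw.bounded R
  exact ⟨K + L, by positivity, fun t ht => (abs_add_le _ _).trans (add_le_add (hK t ht) (hL t ht))⟩

theorem mul (hv : IsControl v) (hw : IsControl w) : IsControl fun t => v t * w t := by
  refine ⟨hv.measurable.mul hw.measurable, fun R => ?_⟩
  obtain ⟨K, hK0, hK⟩ := hv.bounded R
  obtain ⟨L, hL0, hL⟩ := hw.bounded R
  exact ⟨K * L, by positivity, fun t ht => by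
    rw [abs_mul]; exact mul_le_mul (hK t ht) (hL t ht) (abs_nonneg _) hK0⟩

theorem const_mul (hv : IsControl v) (a : ℝ) : IsControl fun t => a * v t := (const a).mul hv

theorem sub (hv : IsControl v) (hw : IsControl w) : IsControl fun t => v t - w t := by
  simpa [sub_eq_add_neg] using hv.add (hw.const_mul (-1))

theorem sq (hv : IsControl v) : IsControl fun t => v t ^ 2 := by
  simpa [_root_.sq] using hv.mul hv

theorem intervalIntegrable (hv : IsControl v) (a b : ℝ) :
    IntervalIntegrable v MeasureTheory.volume a b := by
  obtain ⟨K, -, hK⟩ := hv.bounded (max |a| |b|)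
  refine (intervalIntegrable_const (c := K)).mono_fun hv.measurable.aestronglyMeasurable ?_
  refine (MeasureTheory.ae_restrict_iff' measurableSet_uIoc).2 (Filter.Eventually.of_forall ?_)
  intro t ht
  have h := Set.uIoc_subset_uIcc ht
  have : |t| ≤ max |a| |b| := abs_le_max_abs_abs h.1 h.2 |>.trans (by
    rcases le_total a b with hab | hab
    · simp [hab]
    · simp [hab, max_comm])
  exact (hK t this).trans (le_abs_self _)

theorem continuous_integral (hv : IsControl v) (a : ℝ) : Continuous fun t => ∫ s in a..t, v s :=
  intervalIntegral.continuous_primitive (fun _ _ => hv.intervalIntegrable _ _) a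

end IsControl

/-- Expand the nonnegative integral of (f - m)², where m is the mean of f. -/
theorem sq_integral_le {f : ℝ → ℝ} {a b : ℝ} (hab : a < b)
    (h1 : IntervalIntegrable f MeasureTheory.volume a b)
    (h2 : IntervalIntegrable (fun t => f t ^ 2) MeasureTheory.volume a b) :
    (∫ t in a..b, f t) ^ 2 ≤ (b - a) * ∫ t in a..b, f t ^ 2 := by
  set m := (∫ t in a..b, f t) / (b - a) with hm
  have hba : 0 < b - a := sub_pos.2 hab
  have h : 0 ≤ ∫ t in a..b, (f t - m) ^ 2 :=
    intervalIntegral.integral_nonneg hab.le fun t _ => sq_nonneg _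
  have e : ∫ t in a..b, (f t - m) ^ 2 =
      (∫ t in a..b, f t ^ 2) - 2 * m * (∫ t in a..b, f t) + (b - a) * m ^ 2 := by
    have : (fun t => (f t - m) ^ 2) = fun t => f t ^ 2 - 2 * m * f t + m ^ 2 := by
      funext t; ring
    rw [this, intervalIntegral.integral_add (h2.sub (h1.const_mul _)) intervalIntegrable_const,
      intervalIntegral.integral_sub h2 (h1.const_mul _), intervalIntegral.integral_const_mul,
      intervalIntegral.integral_const, smul_eq_mul]
  have hm' : (∫ t in a..b, f t) = m * (b - a) := by rw [hm]; field_simp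
  rw [e, hm'] at h
  rw [hm']
  nlinarith

/-- The average of `v` over the `i`-th of the intervals of length `h`. -/
noncomputable def average (v : ℝ → ℝ) (h : ℝ) (i : ℕ) : ℝ :=
  (∫ t in (i * h)..((i + 1 : ℕ) * h), v t) / h

theorem abs_average_le {v : ℝ → ℝ} {h K : ℝ} {i : ℕ} (hh : 0 < h)
    (hK : ∀ t ∈ Set.Icc (i * h) ((i + 1 : ℕ) * h), |v t| ≤ K) : |average v h i| ≤ K := by
  have hle : (i * h : ℝ) ≤ (i + 1 : ℕ) * h := by gcongr; simp
  rw [average, abs_div, abs_of_pos hh, div_le_iff₀ hh]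
  have := intervalIntegral.norm_integral_le_of_norm_le_const (f := v) (C := K)
    (a := i * h) (b := (i + 1 : ℕ) * h) fun t ht => by
      rw [Set.uIoc_of_le hle] at ht
      exact hK t ⟨ht.1.le, ht.2⟩
  rw [Real.norm_eq_abs] at this
  refine this.trans_eq ?_
  rw [abs_of_nonneg (sub_nonneg.2 hle)]
  push_cast; ring

/-- Replacing the controls by their averages over short intervals changes the integrals that
define the end point of the path only a little. -/
theorem average_error {v w f : ℝ → ℝ} (hv : IsControl v) (hw : IsControl w) (φ : ℝ)
    (hf : Continuous f) {K R L T h : ℝ} {i : ℕ} (hh : 0 < h) (hi : (i + 1 : ℕ) * h ≤ T)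
    (hKv : ∀ t ∈ Set.Icc 0 T, |v t| ≤ K) (hKw : ∀ t ∈ Set.Icc 0 T, |w t| ≤ K)
    (hR : |φ| + K * T ≤ R) (hL0 : 0 ≤ L)
    (hL : ∀ a b, |a| ≤ R → |b| ≤ R → |f a - f b| ≤ L * |a - b|) :
    |(∫ s in (0 : ℝ)..h, average w h i *
        f (φ + (∫ t in (0 : ℝ)..(i * h), v t) + average v h i * s)) -
      ∫ t in (i * h)..((i + 1 : ℕ) * h), w t * f (φ + ∫ s in (0 : ℝ)..t, v s)| ≤
      2 * (K * (L * (K * h))) * h := by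
  have hi0 : (0 : ℝ) ≤ i * h := by positivity
  have hle : (i * h : ℝ) ≤ (i + 1 : ℕ) * h := by gcongr; simp
  have hlen : ((i + 1 : ℕ) * h : ℝ) - i * h = h := by push_cast; ring
  have hT : 0 ≤ T := hi0.trans (hle.trans hi)
  have hK0 : 0 ≤ K := (abs_nonneg _).trans (hKv 0 ⟨le_rfl, hT⟩)
  have hsub : Set.Icc (i * h : ℝ) ((i + 1 : ℕ) * h) ⊆ Set.Icc 0 T := Set.Icc_subset_Icc hi0 hi
  set ψ : ℝ → ℝ := fun t => φ + ∫ s in (0 : ℝ)..t, v s with hψ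
  have hψc : Continuous ψ := continuous_const.add (hv.continuous_integral 0)
  have hfψ : Continuous fun t => f (ψ t) := hf.comp hψc
  have hav : |average v h i| ≤ K := abs_average_le hh fun t ht => hKv t (hsub ht)
  have haw : |average w h i| ≤ K := abs_average_le hh fun t ht => hKw t (hsub ht)
  have hψd : ∀ t s, 0 ≤ s → s ≤ t → t ≤ T → |ψ t - ψ s| ≤ K * (t - s) := by
    intro t s hs hst ht
    have e : ψ t - ψ s = ∫ r in s..t, v r := by
      simp only [hψ, add_sub_add_left_eq_sub]
      exact intervalIntegral.integral_interval_sub_left (hv.intervalIntegrable _ _)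
        (hv.intervalIntegrable _ _)
    rw [e, ← Real.norm_eq_abs, ← abs_of_nonneg (sub_nonneg.2 hst)]
    refine intervalIntegral.norm_integral_le_of_norm_le_const fun r hr => ?_
    rw [Set.uIoc_of_le hst] at hr
    exact hKv r ⟨hs.trans hr.1.le, hr.2.trans ht⟩
  have hψ0 : ψ 0 = φ := by simp [hψ]
  have hψb : ∀ t, 0 ≤ t → t ≤ T → |ψ t| ≤ |φ| + K * t := by
    intro t h0 ht
    have h1 := hψd t 0 le_rfl h0 ht
    rw [hψ0, sub_zero] at h1
    have h2 := abs_add_le φ (ψ t - φ)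
    rw [add_sub_cancel] at h2
    linarith
  have hψi : |ψ (i * h)| ≤ |φ| + K * (i * h) := hψb _ hi0 (hle.trans hi)
  have hψR : ∀ t, 0 ≤ t → t ≤ T → |ψ t| ≤ R := fun t h0 ht => (hψb t h0 ht).trans
    ((add_le_add le_rfl (mul_le_mul_of_nonneg_left ht hK0)).trans hR)
  -- Both integrals are compared with the one where the angle is frozen at its value at the left
  -- end; each comparison costs K · L · (Kh) on an interval of length h.
  have e₁ : |(∫ s in (0 : ℝ)..h, average w h i * f (ψ (i * h) + average v h i * s)) -
      ∫ s in (0 : ℝ)..h, average w h i * f (ψ (i * h))| ≤ K * (L * (K * h)) * h := by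
    rw [← intervalIntegral.integral_sub (Continuous.intervalIntegrable (by fun_prop) _ _)
      (Continuous.intervalIntegrable (by fun_prop) _ _)]
    have := intervalIntegral.norm_integral_le_of_norm_le_const
      (f := fun s => average w h i * f (ψ (i * h) + average v h i * s) -
        average w h i * f (ψ (i * h))) (C := K * (L * (K * h))) (a := 0) (b := h) fun s hs => by
        rw [Set.uIoc_of_le hh.le] at hs
        rw [← mul_sub, Real.norm_eq_abs, abs_mul]
        have hb : |average v h i * s| ≤ K * h := by
          rw [abs_mul, abs_of_pos hs.1]
          exact mul_le_mul hav hs.2 hs.1.le hK0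
        have hih : (i * h : ℝ) + h ≤ T := by linarith [hlen]
        have h1 := hL (ψ (i * h) + average v h i * s) (ψ (i * h))
          ((abs_add_le _ _).trans (by nlinarith)) (hψR _ hi0 (hle.trans hi))
        rw [add_sub_cancel_left] at h1
        exact mul_le_mul haw (h1.trans (mul_le_mul_of_nonneg_left hb hL0)) (abs_nonneg _) hK0
    rwa [Real.norm_eq_abs, sub_zero, abs_of_pos hh] at this
  have e₂ : |(∫ t in (i * h)..((i + 1 : ℕ) * h), w t * f (ψ (i * h))) -
      ∫ t in (i * h)..((i + 1 : ℕ) * h), w t * f (ψ t)| ≤ K * (L * (K * h)) * h := by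
    rw [← intervalIntegral.integral_sub ((hw.intervalIntegrable _ _).mul_const _)
      ((hw.mul (IsControl.of_continuous hfψ)).intervalIntegrable _ _)]
    have := intervalIntegral.norm_integral_le_of_norm_le_const
      (f := fun t => w t * f (ψ (i * h)) - w t * f (ψ t)) (C := K * (L * (K * h)))
      (a := i * h) (b := (i + 1 : ℕ) * h) fun s hs => by
        rw [Set.uIoc_of_le hle] at hs
        rw [← mul_sub, Real.norm_eq_abs, abs_mul]
        have hs' := hsub ⟨hs.1.le, hs.2⟩
        have h1 := hL (ψ (i * h)) (ψ s) (hψR _ hi0 (hle.trans hi)) (hψR _ hs'.1 hs'.2)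
        rw [abs_sub_comm (ψ (i * h))] at h1
        have h2 := hψd s (i * h) hi0 hs.1.le hs'.2
        have h3 : K * (s - i * h) ≤ K * h :=
          mul_le_mul_of_nonneg_left (by linarith [hs.2]) hK0
        exact mul_le_mul (hKw s hs') (h1.trans (mul_le_mul_of_nonneg_left (h2.trans h3) hL0))
          (abs_nonneg _) hK0
    rwa [Real.norm_eq_abs, hlen, abs_of_pos hh] at this
  -- With the angle frozen, averaging w changes nothing.
  have e₃ : ∫ s in (0 : ℝ)..h, average w h i * f (ψ (i * h)) =
      ∫ t in (i * h)..((i + 1 : ℕ) * h), w t * f (ψ (i * h)) := by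
    rw [intervalIntegral.integral_const, intervalIntegral.integral_mul_const, average]
    simp only [smul_eq_mul]; field_simp; ring
  rw [e₃] at e₁
  have := (abs_sub_le _ _ _).trans (add_le_add e₁ e₂)
  linarith

theorem abs_sub_le_of_abs_deriv_le {f f' : ℝ → ℝ} {R L : ℝ} (hf : ∀ t, HasDerivAt f (f' t) t)
    (hL : ∀ t, |t| ≤ R → |f' t| ≤ L) (a b : ℝ) (ha : |a| ≤ R) (hb : |b| ≤ R) :
    |f a - f b| ≤ L * |a - b| :=
  (convex_Icc (-R) R).norm_image_sub_le_of_norm_hasDerivWithin_le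
    (fun t _ => (hf t).hasDerivWithinAt) (fun t ht => hL t (abs_le.2 ht))
    (abs_le.1 hb) (abs_le.1 ha)

theorem abs_cosh_sub_le {R : ℝ} (a b : ℝ) (ha : |a| ≤ R) (hb : |b| ≤ R) :
    |Real.cosh a - Real.cosh b| ≤ Real.cosh R * |a - b| := by
  refine abs_sub_le_of_abs_deriv_le Real.hasDerivAt_cosh (fun t ht => ?_) a b ha hb
  rw [Real.abs_sinh]
  exact (Real.sinh_lt_cosh _).le.trans
    (Real.cosh_le_cosh.2 (by simpa using ht.trans (le_abs_self R)))

theorem abs_sinh_sub_le {R : ℝ} (a b : ℝ) (ha : |a| ≤ R) (hb : |b| ≤ R) :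
    |Real.sinh a - Real.sinh b| ≤ Real.cosh R * |a - b| := by
  refine abs_sub_le_of_abs_deriv_le Real.hasDerivAt_sinh (fun t ht => ?_) a b ha hb
  rw [abs_of_pos (Real.cosh_pos _)]
  exact Real.cosh_le_cosh.2 (ht.trans (le_abs_self R))

/-- The sum has at least one term, so that the distance of a point from itself does not enter. -/
theorem sRdist_le_sum {q : ℕ → SH2} {d : ℕ → ℝ} (hd : ∀ i, 0 ≤ d i)
    (h : ∀ i, sRdist (q i) (q (i + 1)) ≤ ENNReal.ofReal (d i)) (n : ℕ) :
    sRdist (q 0) (q (n + 1)) ≤ ENNReal.ofReal (∑ i ∈ Finset.range (n + 1), d i) := by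
  induction n with
  | zero => simpa using h 0
  | succ n ih =>
    rw [Finset.sum_range_succ, ENNReal.ofReal_add (Finset.sum_nonneg fun i _ => hd i) (hd _)]
    exact (sRdist_triangle _ _ _).trans (add_le_add ih (h _))

/-- The distance of the end points of a path with measurable controls is at most its length. -/
theorem sRdist_le_of_isControl {v w : ℝ → ℝ} (hv : IsControl v) (hw : IsControl w)
    (φ x y : ℝ) {T : ℝ} (hT : 0 < T) :
    sRdist (ofCoords φ x y) (ofCoords (φ + ∫ t in (0 : ℝ)..T, v t)
      (x + ∫ t in (0 : ℝ)..T, w t * Real.cosh (φ + ∫ s in (0 : ℝ)..t, v s))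
      (y + ∫ t in (0 : ℝ)..T, w t * Real.sinh (φ + ∫ s in (0 : ℝ)..t, v s))) ≤
      ENNReal.ofReal (Real.sqrt (T * ∫ t in (0 : ℝ)..T, (v t ^ 2 + w t ^ 2))) := by
  obtain ⟨K₁, hK₁0, hK₁⟩ := hv.bounded T
  obtain ⟨K₂, hK₂0, hK₂⟩ := hw.bounded T
  set K := max K₁ K₂
  have hKv : ∀ t ∈ Set.Icc 0 T, |v t| ≤ K := fun t ht =>
    (hK₁ t (by rw [abs_of_nonneg ht.1]; exact ht.2)).trans (le_max_left _ _)
  have hKw : ∀ t ∈ Set.Icc 0 T, |w t| ≤ K := fun t ht =>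
    (hK₂ t (by rw [abs_of_nonneg ht.1]; exact ht.2)).trans (le_max_right _ _)
  have hK0 : 0 ≤ K := hK₁0.trans (le_max_left _ _)
  set R := |φ| + K * T with hR
  set ψ : ℝ → ℝ := fun t => φ + ∫ s in (0 : ℝ)..t, v s with hψ
  have hψc : Continuous ψ := continuous_const.add (hv.continuous_integral 0)
  have hE : IsControl fun t => v t ^ 2 + w t ^ 2 := hv.sq.add hw.sq
  -- the estimate for piecewise constant controls
  have key : ∀ n : ℕ, ∃ x' y' : ℝ,
      |x + (∫ t in (0 : ℝ)..T, w t * Real.cosh (ψ t)) - x'| ≤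
        2 * K ^ 2 * Real.cosh R * T ^ 2 / (n + 1) ∧
      |y + (∫ t in (0 : ℝ)..T, w t * Real.sinh (ψ t)) - y'| ≤
        2 * K ^ 2 * Real.cosh R * T ^ 2 / (n + 1) ∧
      sRdist (ofCoords φ x y) (ofCoords (ψ T) x' y') ≤
        ENNReal.ofReal (Real.sqrt (T * ∫ t in (0 : ℝ)..T, (v t ^ 2 + w t ^ 2))) := by
    intro n
    set h := T / (n + 1) with hh'
    have hh : 0 < h := by positivity
    have hnh : ((n + 1 : ℕ) : ℝ) * h = T := by rw [hh']; push_cast; field_simp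
    have hih : ∀ i ∈ Finset.range (n + 1), ((i + 1 : ℕ) : ℝ) * h ≤ T := fun i hi => by
      rw [← hnh]; gcongr; simpa using hi
    have herr : ∀ f : ℝ → ℝ, Continuous f →
        (∀ a b, |a| ≤ R → |b| ≤ R → |f a - f b| ≤ Real.cosh R * |a - b|) → ∀ z : ℝ,
        |z + (∫ t in (0 : ℝ)..T, w t * f (ψ t)) - (z + ∑ i ∈ Finset.range (n + 1),
          ∫ s in (0 : ℝ)..h, average w h i * f (ψ (i * h) + average v h i * s))| ≤
        2 * K ^ 2 * Real.cosh R * T ^ 2 / (n + 1) := by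
      intro f hf hfL z
      have hfψ : Continuous fun t => f (ψ t) := hf.comp hψc
      have hint : ∫ t in (0 : ℝ)..T, w t * f (ψ t) = ∑ i ∈ Finset.range (n + 1),
          ∫ t in (i * h)..((i + 1 : ℕ) * h), w t * f (ψ t) := by
        rw [intervalIntegral.sum_integral_adjacent_intervals (a := fun i : ℕ => (i : ℝ) * h)
          fun i _ => (hw.mul (IsControl.of_continuous hfψ)).intervalIntegrable _ _]
        rw [hnh]; simp
      rw [add_sub_add_left_eq_sub, hint, abs_sub_comm, ← Finset.sum_sub_distrib]
      refine (Finset.abs_sum_le_sum_abs _ _).trans ((Finset.sum_le_sum fun i hi =>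
        average_error hv hw φ hf hh (hih i hi) hKv hKw hR.ge (Real.cosh_pos R).le hfL).trans_eq ?_)
      rw [Finset.sum_const, Finset.card_range, nsmul_eq_mul, hh']
      push_cast; field_simp
    set xs : ℕ → ℝ := fun k => x + ∑ i ∈ Finset.range k,
      ∫ s in (0 : ℝ)..h, average w h i * Real.cosh (ψ (i * h) + average v h i * s) with hxs
    set ys : ℕ → ℝ := fun k => y + ∑ i ∈ Finset.range k,
      ∫ s in (0 : ℝ)..h, average w h i * Real.sinh (ψ (i * h) + average v h i * s) with hys
    refine ⟨xs (n + 1), ys (n + 1), herr _ Real.continuous_cosh abs_cosh_sub_le x,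
      herr _ Real.continuous_sinh abs_sinh_sub_le y, ?_⟩
    have hstep : ∀ i : ℕ, sRdist (ofCoords (ψ (i * h)) (xs i) (ys i))
        (ofCoords (ψ ((i + 1 : ℕ) * h)) (xs (i + 1)) (ys (i + 1))) ≤
        ENNReal.ofReal (h * Real.sqrt (average v h i ^ 2 + average w h i ^ 2)) := by
      intro i
      -- Averaging preserves the angle at the nodes, so the approximating path ends with exactly the
      -- angle ψ(T), and only its translation part needs correction.
      have e₁ : ψ ((i + 1 : ℕ) * h) = ψ (i * h) + average v h i * h := by
        rw [average, div_mul_cancel₀ _ hh.ne']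
        simp only [hψ, add_assoc]
        rw [intervalIntegral.integral_add_adjacent_intervals (hv.intervalIntegrable _ _)
          (hv.intervalIntegrable _ _)]
      rw [e₁]
      simp only [hxs, hys, Finset.sum_range_succ, ← add_assoc]
      exact sRdist_le_of_const_control _ _ _ _ _ hh.le
    have hsum := sRdist_le_sum (q := fun i : ℕ => ofCoords (ψ (i * h)) (xs i) (ys i))
      (d := fun i => h * Real.sqrt (average v h i ^ 2 + average w h i ^ 2))
      (fun i => by positivity) hstep n
    have h0 : ofCoords (ψ ((0 : ℕ) * h)) (xs 0) (ys 0) = ofCoords φ x y := by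
      simp [hψ, hxs, hys]
    simp only [hnh, h0] at hsum
    refine hsum.trans (ENNReal.ofReal_le_ofReal (Real.le_sqrt_of_sq_le ?_))
    -- Cauchy-Schwarz is used twice: here over the intervals, and in `hsq` inside each of them, so
    -- that averaging does not increase the energy.
    have hcs := sq_sum_le_card_mul_sum_sq (s := Finset.range (n + 1))
      (f := fun i => h * Real.sqrt (average v h i ^ 2 + average w h i ^ 2))
    refine hcs.trans ?_
    rw [Finset.card_range]
    have hint : ∫ t in (0 : ℝ)..T, (v t ^ 2 + w t ^ 2) = ∑ i ∈ Finset.range (n + 1),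
        ∫ t in (i * h)..((i + 1 : ℕ) * h), (v t ^ 2 + w t ^ 2) := by
      rw [intervalIntegral.sum_integral_adjacent_intervals (a := fun i : ℕ => (i : ℝ) * h)
        fun i _ => hE.intervalIntegrable _ _]
      rw [hnh]; simp
    have hTE : T * ∑ i ∈ Finset.range (n + 1),
        ∫ t in (i * h)..((i + 1 : ℕ) * h), (v t ^ 2 + w t ^ 2) = (n + 1 : ℕ) *
        ∑ i ∈ Finset.range (n + 1), h * ∫ t in (i * h)..((i + 1 : ℕ) * h), (v t ^ 2 + w t ^ 2) := by
      rw [← Finset.mul_sum, ← mul_assoc, hnh]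
    rw [hint, hTE]
    refine mul_le_mul_of_nonneg_left (Finset.sum_le_sum fun i _ => ?_) (Nat.cast_nonneg _)
    have hlt : (i * h : ℝ) < (i + 1 : ℕ) * h := by gcongr; simp
    have hlen : ((i + 1 : ℕ) * h : ℝ) - i * h = h := by push_cast; ring
    have hsq : ∀ {u : ℝ → ℝ}, IsControl u → (h * average u h i) ^ 2 ≤
        h * ∫ t in (i * h)..((i + 1 : ℕ) * h), u t ^ 2 := fun {u} hu => by
      rw [average, mul_div_cancel₀ _ hh.ne']
      simpa only [hlen] using sq_integral_le hlt (hu.intervalIntegrable _ _)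
        (hu.sq.intervalIntegrable _ _)
    rw [mul_pow, Real.sq_sqrt (by positivity), intervalIntegral.integral_add
      (hv.sq.intervalIntegrable _ _) (hw.sq.intervalIntegrable _ _)]
    linarith [hsq hv, hsq hw]
  refine ENNReal.le_of_forall_pos_le_add fun ε hε _ => ?_
  have hε' : (0 : ℝ) < ε := hε
  -- The turns of the correcting path cost 4a = ε/2. With a fixed, n is taken so large that its
  -- translations cost less than ε/2.
  set a : ℝ := ε / 8 with ha
  have ha0 : 0 < a := by positivity
  set M := 2 * Real.cosh (|ψ T| + a) / Real.sinh (2 * a)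
  have hM : 0 ≤ M := by
    have : 0 < Real.sinh (2 * a) := Real.sinh_pos_iff.2 (by linarith)
    have := Real.cosh_pos (|ψ T| + a)
    positivity
  have hlim : Filter.Tendsto (fun n : ℕ => (2 * (2 * K ^ 2 * Real.cosh R * T ^ 2) * M) /
      ((n : ℝ) + 1)) Filter.atTop (nhds 0) :=
    tendsto_const_div_atTop_nhds_zero_nat (2 * (2 * K ^ 2 * Real.cosh R * T ^ 2) * M)
      |>.comp (Filter.tendsto_add_atTop_nat 1) |>.congr
      fun n => by simp
  obtain ⟨n, hn⟩ := (hlim.eventually (gt_mem_nhds (half_pos hε'))).exists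
  obtain ⟨x', y', hx', hy', hd⟩ := key n
  refine (sRdist_triangle _ _ _).trans (add_le_add hd ?_)
  refine (sRdist_le_of_rapidity_eq _ _ _ _ _ ha0).trans ?_
  rw [← ENNReal.ofReal_coe_nnreal]
  apply ENNReal.ofReal_le_ofReal
  have h1 := mul_le_mul_of_nonneg_right (add_le_add hx' hy') hM
  have h2 : (2 * K ^ 2 * Real.cosh R * T ^ 2 / (n + 1) +
      2 * K ^ 2 * Real.cosh R * T ^ 2 / (n + 1)) * M =
      (2 * (2 * K ^ 2 * Real.cosh R * T ^ 2) * M) / ((n : ℝ) + 1) := by ring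
  rw [h2] at h1
  have h3 : 4 * a = ε / 2 := by rw [ha]; ring
  linarith

/-! ### The variational problem -/

theorem IsControl.ae_eq_zero {f : ℝ → ℝ} (hf : IsControl f) {T : ℝ} (hT : 0 ≤ T)
    (h : ∫ t in (0 : ℝ)..T, f t ^ 2 ≤ 0) : ∀ᵐ t, t ∈ Set.Ioc 0 T → f t = 0 := by
  have h0 : ∫ t in (0 : ℝ)..T, f t ^ 2 = 0 :=
    le_antisymm h (intervalIntegral.integral_nonneg hT fun t _ => sq_nonneg _)
  rw [intervalIntegral.integral_eq_zero_iff_of_le_of_nonneg_ae hT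
    (Filter.Eventually.of_forall fun t => sq_nonneg _) (hf.sq.intervalIntegrable _ _)] at h0
  have := (MeasureTheory.ae_restrict_iff' measurableSet_Ioc).1 h0
  filter_upwards [this] with t ht hm
  simpa using ht hm

/-- Integration by parts for primitives of controls. -/
theorem IsControl.integral_mul_primitive {f g : ℝ → ℝ} (hf : IsControl f) (hg : IsControl g)
    (T : ℝ) :
    (∫ t in (0 : ℝ)..T, f t * ∫ s in (0 : ℝ)..t, g s) +
      (∫ t in (0 : ℝ)..T, (∫ s in (0 : ℝ)..t, f s) * g t) =
      (∫ t in (0 : ℝ)..T, f t) * ∫ t in (0 : ℝ)..T, g t := by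
  have hF := (hf.intervalIntegrable 0 T).absolutelyContinuousOnInterval_intervalIntegral
    (c := 0) (by simp)
  have hG := (hg.intervalIntegrable 0 T).absolutelyContinuousOnInterval_intervalIntegral
    (c := 0) (by simp)
  have h := hF.integral_deriv_mul_eq_sub hG
  rw [← intervalIntegral.integral_add
    ((hf.mul (of_continuous (hg.continuous_integral 0))).intervalIntegrable _ _)
    (((of_continuous (hf.continuous_integral 0)).mul hg).intervalIntegrable _ _)]
  simp only [intervalIntegral.integral_same, mul_zero, sub_zero] at h
  rw [← h]
  refine intervalIntegral.integral_congr_ae ?_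
  filter_upwards [(hf.intervalIntegrable 0 T).ae_hasDerivAt_integral,
    (hg.intervalIntegrable 0 T).ae_hasDerivAt_integral] with t h1 h2 ht
  have ht' := Set.uIoc_subset_uIcc ht
  rw [(h1 ht' 0 (by simp)).deriv, (h2 ht' 0 (by simp)).deriv]

/-- Differentiation under the integral sign, dominated on |ε| < 1. With c = 2 and c = -2 it gives
the variation of the diagonal entries of the Gram matrix. -/
theorem hasDerivAt_integral_exp {φ η : ℝ → ℝ} (hφ : Continuous φ) (hη : Continuous η) (c T : ℝ) :
    HasDerivAt (fun ε => ∫ t in (0 : ℝ)..T, Real.exp (c * (φ t + ε * η t)))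
      (∫ t in (0 : ℝ)..T, c * η t * Real.exp (c * φ t)) 0 := by
  have := (intervalIntegral.hasDerivAt_integral_of_dominated_loc_of_deriv_le
    (F := fun ε t => Real.exp (c * (φ t + ε * η t)))
    (F' := fun ε t => c * η t * Real.exp (c * (φ t + ε * η t)))
    (bound := fun t => |c * η t| * Real.exp (|c| * (|φ t| + |η t|)))
    (x₀ := 0) (μ := MeasureTheory.volume) (a := 0) (b := T)
    (Metric.ball_mem_nhds (0 : ℝ) one_pos) (Filter.Eventually.of_forall fun ε =>
      (by fun_prop : Continuous fun t => Real.exp (c * (φ t + ε * η t))).aestronglyMeasurable)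
    (Continuous.intervalIntegrable (by fun_prop) _ _)
    (by fun_prop : Continuous fun t => c * η t * Real.exp (c * (φ t + 0 * η t))).aestronglyMeasurable
    (Filter.Eventually.of_forall fun t _ ε hε => ?_)
    (Continuous.intervalIntegrable (by fun_prop) _ _)
    (Filter.Eventually.of_forall fun t _ ε _ => ?_)).2
  · simpa using this
  · rw [Metric.mem_ball, dist_zero_right, Real.norm_eq_abs] at hε
    rw [Real.norm_eq_abs, abs_mul, abs_of_pos (Real.exp_pos _)]
    refine mul_le_mul_of_nonneg_left (Real.exp_le_exp.2 ?_) (abs_nonneg _)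
    refine (le_abs_self _).trans ?_
    rw [abs_mul]
    refine mul_le_mul_of_nonneg_left ((abs_add_le _ _).trans ?_) (abs_nonneg c)
    rw [abs_mul]
    nlinarith [abs_nonneg (η t)]
  · refine ((((hasDerivAt_id ε).mul_const (η t)).const_add (φ t)).const_mul c).exp.congr_deriv ?_
    simp; ring

theorem exp_mul_exp_neg (s : ℝ) : Real.exp s * Real.exp (-s) = 1 := by
  rw [← Real.exp_add]; simp

theorem exp_two_mul (s : ℝ) : Real.exp (2 * s) = Real.exp s ^ 2 := by
  rw [two_mul, Real.exp_add, sq]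

theorem exp_neg_two_mul (s : ℝ) : Real.exp (-2 * s) = Real.exp (-s) ^ 2 := by
  rw [← exp_two_mul]; ring_nf

/-- Since exp ψ · exp(-ψ) = 1, the off-diagonal entry of the Gram matrix is T, whatever ψ is. -/
theorem integral_combination {ψ : ℝ → ℝ} (hψ : Continuous ψ) (a b T : ℝ) :
    (∫ t in (0 : ℝ)..T, (a * Real.exp (ψ t) + b * Real.exp (-ψ t)) * Real.exp (ψ t)) =
      a * (∫ t in (0 : ℝ)..T, Real.exp (2 * ψ t)) + b * T ∧
    (∫ t in (0 : ℝ)..T, (a * Real.exp (ψ t) + b * Real.exp (-ψ t)) * Real.exp (-ψ t)) =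
      a * T + b * ∫ t in (0 : ℝ)..T, Real.exp (-2 * ψ t) := by
  constructor
  · have : ∀ t, (a * Real.exp (ψ t) + b * Real.exp (-ψ t)) * Real.exp (ψ t) =
        a * Real.exp (2 * ψ t) + b := fun t => by
      rw [exp_two_mul]; linear_combination b * exp_mul_exp_neg (ψ t)
    simp only [this]
    rw [intervalIntegral.integral_add (Continuous.intervalIntegrable (by fun_prop) _ _)
      (by simp)]
    simp; ring
  · have : ∀ t, (a * Real.exp (ψ t) + b * Real.exp (-ψ t)) * Real.exp (-ψ t) =
        a + b * Real.exp (-2 * ψ t) := fun t => by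
      rw [exp_neg_two_mul]; linear_combination a * exp_mul_exp_neg (ψ t)
    simp only [this]
    rw [intervalIntegral.integral_add (by simp) (Continuous.intervalIntegrable (by fun_prop) _ _)]
    simp; ring

theorem integral_mul_combination {ψ w : ℝ → ℝ} (hψ : Continuous ψ) (hw : IsControl w) (a b T : ℝ) :
    (∫ t in (0 : ℝ)..T, w t * (a * Real.exp (ψ t) + b * Real.exp (-ψ t))) =
      a * (∫ t in (0 : ℝ)..T, w t * Real.exp (ψ t)) +
      b * ∫ t in (0 : ℝ)..T, w t * Real.exp (-ψ t) := by
  have h1 : IsControl fun t => w t * Real.exp (ψ t) :=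
    hw.mul (IsControl.of_continuous (by fun_prop))
  have h2 : IsControl fun t => w t * Real.exp (-ψ t) :=
    hw.mul (IsControl.of_continuous (by fun_prop))
  rw [← intervalIntegral.integral_const_mul, ← intervalIntegral.integral_const_mul,
    ← intervalIntegral.integral_add ((h1.const_mul _).intervalIntegrable _ _)
      ((h2.const_mul _).intervalIntegrable _ _)]
  congr 1; funext t; ring

/-- The Gram determinant of `exp ψ`, `exp (-ψ)` in `L²(0, T)`. -/
noncomputable def gramDet (ψ : ℝ → ℝ) (T : ℝ) : ℝ :=
  (∫ t in (0 : ℝ)..T, Real.exp (2 * ψ t)) * (∫ t in (0 : ℝ)..T, Real.exp (-2 * ψ t)) - T ^ 2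

theorem integral_exp_pos {ψ : ℝ → ℝ} (hψ : Continuous ψ) {T : ℝ} (hT : 0 < T) (c : ℝ) :
    0 < ∫ t in (0 : ℝ)..T, Real.exp (c * ψ t) :=
  intervalIntegral.intervalIntegral_pos_of_pos (Continuous.intervalIntegrable (by fun_prop) _ _)
    (fun _ => Real.exp_pos _) hT

/-- The equality case of Cauchy-Schwarz: if exp ψ were proportional to exp(-ψ), then exp(2ψ), and
hence ψ, would be constant. -/
theorem gramDet_pos {ψ : ℝ → ℝ} (hψ : Continuous ψ) {T : ℝ} (hT : 0 < T)
    (hne : ∃ t ∈ Set.Icc 0 T, ψ t ≠ ψ 0) : 0 < gramDet ψ T := by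
  by_contra! hle
  set K := ∫ t in (0 : ℝ)..T, Real.exp (2 * ψ t) with hK
  set K' := ∫ t in (0 : ℝ)..T, Real.exp (-2 * ψ t) with hK'
  have hK'0 : 0 < K' := integral_exp_pos hψ hT (-2)
  have hD : K * K' - T ^ 2 ≤ 0 := hle
  -- The coefficient of the orthogonal projection of exp ψ to exp(-ψ); the squared norm of the
  -- remainder is (KK' - T²)/K'.
  set r := T / K' with hr
  have hc : Continuous fun t => Real.exp (ψ t) + -r * Real.exp (-ψ t) := by fun_prop
  have hint : ∫ t in (0 : ℝ)..T, (Real.exp (ψ t) + -r * Real.exp (-ψ t)) ^ 2 ≤ 0 := by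
    obtain ⟨e1, e2⟩ := integral_combination hψ 1 (-r) T
    have e3 := integral_mul_combination hψ (IsControl.of_continuous hc) 1 (-r) T
    simp only [one_mul] at e1 e2 e3
    simp only [sq, e3, e1, e2]
    rw [← hK, ← hK']
    have : K + -r * T + -r * (T + -r * K') = (K * K' - T ^ 2) / K' := by
      rw [hr]; field_simp; ring
    rw [this]
    exact div_nonpos_of_nonpos_of_nonneg hD hK'0.le
  obtain ⟨t, ht, hne⟩ := hne
  have hz : ∀ s ∈ Set.Icc 0 T, Real.exp (ψ s) + -r * Real.exp (-ψ s) = 0 := by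
    intro s hs
    by_contra h
    refine hint.not_gt ?_
    exact intervalIntegral.integral_pos hT (by fun_prop) (fun _ _ => sq_nonneg _)
      ⟨s, hs, by positivity⟩
  have hr' : ∀ s ∈ Set.Icc 0 T, Real.exp (2 * ψ s) = r := fun s hs => by
    rw [exp_two_mul]
    linear_combination Real.exp (ψ s) * hz s hs + r * exp_mul_exp_neg (ψ s)
  have := Real.exp_injective ((hr' t ht).trans (hr' 0 ⟨le_rfl, hT.le⟩).symm)
  exact hne (by linarith)

/-- The Euler-Lagrange equations of the minimizers of the energy `∫ u₁² + u₂²` among the controls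
with given values of `∫ u₁` and `∫ u₂ exp(±φ)`, where `φ` is the primitive of `u₁`. -/
theorem euler_lagrange {u₁ u₂ : ℝ → ℝ} (h₁ : IsControl u₁) (h₂ : IsControl u₂) {φ : ℝ → ℝ}
    {φ₀ T : ℝ} (hφ : ∀ t, φ t = φ₀ + ∫ s in (0 : ℝ)..t, u₁ s) (hT : 0 < T)
    (hmin : ∀ v w ψ : ℝ → ℝ, IsControl v → IsControl w →
      (∀ t, ψ t = φ₀ + ∫ s in (0 : ℝ)..t, v s) → ψ T = φ T →
      (∫ t in (0 : ℝ)..T, w t * Real.exp (ψ t)) = (∫ t in (0 : ℝ)..T, u₂ t * Real.exp (φ t)) →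
      (∫ t in (0 : ℝ)..T, w t * Real.exp (-ψ t)) = (∫ t in (0 : ℝ)..T, u₂ t * Real.exp (-φ t)) →
      ∫ t in (0 : ℝ)..T, (u₁ t ^ 2 + u₂ t ^ 2) ≤ ∫ t in (0 : ℝ)..T, (v t ^ 2 + w t ^ 2))
    (hne : ∃ t ∈ Set.Icc 0 T, φ t ≠ φ 0) :
    ∃ a b m : ℝ,
      (∀ᵐ t, t ∈ Set.Ioc 0 T → u₂ t = a * Real.exp (φ t) + b * Real.exp (-φ t)) ∧
      (∀ᵐ t, t ∈ Set.Ioc 0 T → u₁ t = m - ∫ s in (0 : ℝ)..t,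
        (a ^ 2 * Real.exp (2 * φ s) - b ^ 2 * Real.exp (-2 * φ s))) := by
  have hφc : Continuous φ := by
    rw [show φ = fun t => φ₀ + ∫ s in (0 : ℝ)..t, u₁ s from funext hφ]
    exact continuous_const.add (h₁.continuous_integral 0)
  have hsplit : ∀ v w : ℝ → ℝ, IsControl v → IsControl w → ∫ t in (0 : ℝ)..T, (v t ^ 2 + w t ^ 2) =
      (∫ t in (0 : ℝ)..T, v t ^ 2) + ∫ t in (0 : ℝ)..T, w t ^ 2 := fun v w hv hw =>
    intervalIntegral.integral_add (hv.sq.intervalIntegrable _ _) (hw.sq.intervalIntegrable _ _)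
  set p := ∫ t in (0 : ℝ)..T, u₂ t * Real.exp (φ t) with hp
  set q := ∫ t in (0 : ℝ)..T, u₂ t * Real.exp (-φ t) with hq
  set k : (ℝ → ℝ) → ℝ := fun ψ => ∫ t in (0 : ℝ)..T, Real.exp (2 * ψ t) with hk
  set k' : (ℝ → ℝ) → ℝ := fun ψ => ∫ t in (0 : ℝ)..T, Real.exp (-2 * ψ t) with hk'
  -- The least value of ∫ w² under the two constraints: the quadratic form of the inverse Gram
  -- matrix at (p, q).
  set F : (ℝ → ℝ) → ℝ := fun ψ =>
    (p ^ 2 * k' ψ - 2 * p * q * T + q ^ 2 * k ψ) / (k ψ * k' ψ - T ^ 2) with hF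
  -- the optimal second control for a given angle
  have hopt : ∀ ψ : ℝ → ℝ, Continuous ψ → 0 < k ψ * k' ψ - T ^ 2 → ∀ a b : ℝ,
      a = (p * k' ψ - q * T) / (k ψ * k' ψ - T ^ 2) →
      b = (q * k ψ - p * T) / (k ψ * k' ψ - T ^ 2) →
      (∫ t in (0 : ℝ)..T, (a * Real.exp (ψ t) + b * Real.exp (-ψ t)) * Real.exp (ψ t)) = p ∧
      (∫ t in (0 : ℝ)..T, (a * Real.exp (ψ t) + b * Real.exp (-ψ t)) * Real.exp (-ψ t)) = q ∧
      (∫ t in (0 : ℝ)..T, (a * Real.exp (ψ t) + b * Real.exp (-ψ t)) ^ 2) = F ψ ∧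
      a * p + b * q = F ψ := by
    intro ψ hψ hD a b ha hb
    obtain ⟨e1, e2⟩ := integral_combination hψ a b T
    have e3 := integral_mul_combination hψ (w := fun t => a * Real.exp (ψ t) + b * Real.exp (-ψ t))
      (IsControl.of_continuous (by fun_prop)) a b T
    have e1' : a * k ψ + b * T = p := by
      rw [ha, hb, div_mul_eq_mul_div, div_mul_eq_mul_div, ← add_div, div_eq_iff hD.ne']; ring
    have e2' : a * T + b * k' ψ  = q := by
      rw [ha, hb, div_mul_eq_mul_div, div_mul_eq_mul_div, ← add_div, div_eq_iff hD.ne']; ring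
    have e4 : a * p + b * q = F ψ := by rw [ha, hb, hF]; field_simp; ring
    have e1'' := e1.trans e1'
    have e2'' := e2.trans e2'
    refine ⟨e1'', e2'', ?_, e4⟩
    simp only [sq]
    rw [e3, e1'', e2'', e4]
  have hD : 0 < k φ * k' φ - T ^ 2 := gramDet_pos hφc hT hne
  set a := (p * k' φ - q * T) / (k φ * k' φ - T ^ 2) with ha
  set b := (q * k φ - p * T) / (k φ * k' φ - T ^ 2) with hb
  set P : ℝ → ℝ := fun t => a * Real.exp (φ t) + b * Real.exp (-φ t) with hP
  have hPc : IsControl P := IsControl.of_continuous (by fun_prop)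
  obtain ⟨o1, o2, o3, o4⟩ := hopt φ hφc hD a b ha hb
  have hu₂le : ∫ t in (0 : ℝ)..T, u₂ t ^ 2 ≤ F φ := by
    have := hmin u₁ P φ h₁ hPc hφ rfl o1 o2
    rw [hsplit _ _ h₁ h₂, hsplit _ _ h₁ hPc, o3] at this
    linarith
  -- As P is a combination of the constraint functions, its product with u₂ depends only on p and q.
  -- Hence ∫ (u₂ - P)² = ∫ u₂² - F(φ) ≤ 0.
  have hcross : ∫ t in (0 : ℝ)..T, u₂ t * P t = F φ := by
    rw [integral_mul_combination hφc h₂, ← hp, ← hq, o4]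
  have hdiff : ∫ t in (0 : ℝ)..T, (u₂ t - P t) ^ 2 = (∫ t in (0 : ℝ)..T, u₂ t ^ 2) - F φ := by
    have : ∀ t, (u₂ t - P t) ^ 2 = u₂ t ^ 2 - 2 * (u₂ t * P t) + P t ^ 2 := fun t => by ring
    simp only [this]
    rw [intervalIntegral.integral_add
      ((h₂.sq.sub ((h₂.mul hPc).const_mul 2)).intervalIntegrable _ _)
      (hPc.sq.intervalIntegrable _ _), intervalIntegral.integral_sub
      (h₂.sq.intervalIntegrable _ _) (((h₂.mul hPc).const_mul 2).intervalIntegrable _ _),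
      intervalIntegral.integral_const_mul, hcross, o3]
    ring
  have hu₂ : ∀ᵐ t, t ∈ Set.Ioc 0 T → u₂ t - P t = 0 :=
    (h₂.sub hPc).ae_eq_zero hT.le (by rw [hdiff]; linarith)
  have hu₂eq : ∫ t in (0 : ℝ)..T, u₂ t ^ 2 = F φ := by
    have := intervalIntegral.integral_nonneg (μ := MeasureTheory.volume) hT.le
      fun t (_ : t ∈ Set.Icc 0 T) => sq_nonneg (u₂ t - P t)
    linarith
  -- the first variation
  set g : ℝ → ℝ := fun s => a ^ 2 * Real.exp (2 * φ s) - b ^ 2 * Real.exp (-2 * φ s) with hg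
  have hgc : Continuous g := by fun_prop
  have hvar : ∀ ξ : ℝ → ℝ, IsControl ξ → ∫ t in (0 : ℝ)..T, ξ t = 0 →
      ∫ t in (0 : ℝ)..T, u₁ t * ξ t = ∫ t in (0 : ℝ)..T, g t * ∫ s in (0 : ℝ)..t, ξ s := by
    intro ξ hξ hξ0
    set η : ℝ → ℝ := fun t => ∫ s in (0 : ℝ)..t, ξ s with hη
    have hηc : Continuous η := hξ.continuous_integral 0
    set Ψ : ℝ → ℝ → ℝ := fun ε t => φ t + ε * η t with hΨ
    have hΨ0 : Ψ 0 = φ := by funext t; simp [hΨ]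
    have dk := hasDerivAt_integral_exp hφc hηc 2 T
    have dk' := hasDerivAt_integral_exp hφc hηc (-2) T
    set κ := ∫ t in (0 : ℝ)..T, 2 * η t * Real.exp (2 * φ t) with hκ
    set κ' := ∫ t in (0 : ℝ)..T, -2 * η t * Real.exp (-2 * φ t) with hκ'
    have dk₁ : HasDerivAt (fun ε => k (Ψ ε)) κ 0 := dk
    have dk₂ : HasDerivAt (fun ε => k' (Ψ ε)) κ' 0 := dk'
    have dD := (dk₁.mul dk₂).sub_const (T ^ 2)
    -- The derivative of the form of G⁻¹ at (p, q) is minus the form of G' at (a, b) = G⁻¹(p, q);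
    -- the off-diagonal entries of G are constant.
    have dF : HasDerivAt (fun ε => F (Ψ ε)) (-(a ^ 2 * κ + b ^ 2 * κ')) 0 := by
      have h := (((dk₂.const_mul (p ^ 2)).sub_const (2 * p * q * T)).add
        (dk₁.const_mul (q ^ 2))).div dD (by simpa [hΨ0] using hD.ne')
      refine h.congr_deriv ?_
      simp only [Pi.mul_apply, Pi.add_apply, hΨ0]
      rw [ha, hb]
      field_simp
      ring
    have hΨctrl : ∀ ε, IsControl fun t => u₁ t + ε * ξ t := fun ε => h₁.add (hξ.const_mul ε)
    have hquad : ∀ ε, ∫ t in (0 : ℝ)..T, (u₁ t + ε * ξ t) ^ 2 =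
        (∫ t in (0 : ℝ)..T, u₁ t ^ 2) + 2 * ε * (∫ t in (0 : ℝ)..T, u₁ t * ξ t) +
          ε ^ 2 * ∫ t in (0 : ℝ)..T, ξ t ^ 2 := by
      intro ε
      have : ∀ t, (u₁ t + ε * ξ t) ^ 2 = u₁ t ^ 2 + 2 * ε * (u₁ t * ξ t) + ε ^ 2 * ξ t ^ 2 :=
        fun t => by ring
      simp only [this]
      rw [intervalIntegral.integral_add
        ((h₁.sq.add ((h₁.mul hξ).const_mul (2 * ε))).intervalIntegrable _ _)
        ((hξ.sq.const_mul (ε ^ 2)).intervalIntegrable _ _), intervalIntegral.integral_add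
        (h₁.sq.intervalIntegrable _ _) (((h₁.mul hξ).const_mul (2 * ε)).intervalIntegrable _ _),
        intervalIntegral.integral_const_mul, intervalIntegral.integral_const_mul]
    -- This is the energy of the varied angle with its optimal second control. The minimum is only
    -- local because the Gram determinant must stay positive; `hξ0` keeps the final angle fixed.
    have hlm : IsLocalMin (fun ε => (∫ t in (0 : ℝ)..T, u₁ t ^ 2) +
        2 * ε * (∫ t in (0 : ℝ)..T, u₁ t * ξ t) + ε ^ 2 * (∫ t in (0 : ℝ)..T, ξ t ^ 2) +
          F (Ψ ε)) 0 := by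
      have hev : ∀ᶠ ε in nhds (0 : ℝ), 0 < k (Ψ ε) * k' (Ψ ε) - T ^ 2 :=
        dD.continuousAt.eventually (lt_mem_nhds (by simpa [hΨ0] using hD))
      filter_upwards [hev] with ε hε
      have hΨc : Continuous (Ψ ε) := by fun_prop
      obtain ⟨i1, i2, i3, -⟩ := hopt (Ψ ε) hΨc hε _ _ rfl rfl
      have hw : IsControl fun t => (p * k' (Ψ ε) - q * T) / (k (Ψ ε) * k' (Ψ ε) - T ^ 2) *
          Real.exp (Ψ ε t) + (q * k (Ψ ε) - p * T) / (k (Ψ ε) * k' (Ψ ε) - T ^ 2) *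
          Real.exp (-Ψ ε t) := IsControl.of_continuous (by fun_prop)
      have := hmin _ _ (Ψ ε) (hΨctrl ε) hw (fun t => by
        rw [intervalIntegral.integral_add (h₁.intervalIntegrable _ _)
          ((hξ.const_mul ε).intervalIntegrable _ _), intervalIntegral.integral_const_mul,
          ← add_assoc, ← hφ]) (by simp [hΨ, hη, hξ0]) i1 i2
      rw [hsplit _ _ h₁ h₂, hsplit _ _ (hΨctrl ε) hw, i3, hu₂eq, hquad] at this
      simpa [hΨ0] using this
    have hd := hlm.hasDerivAt_eq_zero (((((hasDerivAt_id (0 : ℝ)).const_mul 2).mul_const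
      (∫ t in (0 : ℝ)..T, u₁ t * ξ t)).const_add (∫ t in (0 : ℝ)..T, u₁ t ^ 2)).add
      (((hasDerivAt_id (0 : ℝ)).pow 2).mul_const (∫ t in (0 : ℝ)..T, ξ t ^ 2)) |>.add dF)
    have hgη : ∫ t in (0 : ℝ)..T, g t * η t = a ^ 2 * (κ / 2) + b ^ 2 * (κ' / 2) := by
      rw [hκ, hκ', ← intervalIntegral.integral_div, ← intervalIntegral.integral_div,
        ← intervalIntegral.integral_const_mul, ← intervalIntegral.integral_const_mul,
        ← intervalIntegral.integral_add (Continuous.intervalIntegrable (by fun_prop) _ _)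
          (Continuous.intervalIntegrable (by fun_prop) _ _)]
      congr 1; funext t; simp only [hg]; ring
    rw [hgη]
    simp at hd
    linarith
  -- the lemma of du Bois-Reymond
  set H : ℝ → ℝ := fun t => ∫ s in (0 : ℝ)..t, g s with hH
  have hgC : IsControl g := IsControl.of_continuous hgc
  have hHC : IsControl H := IsControl.of_continuous (hgC.continuous_integral 0)
  have huH : IsControl fun t => u₁ t + H t := h₁.add hHC
  -- Subtracting the mean makes ξ an admissible variation. Integration by parts turns the first
  -- variation into ∫ (u₁ + H) ξ = 0, and therefore ∫ ξ² = 0.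
  set m := (∫ t in (0 : ℝ)..T, (u₁ t + H t)) / T with hm
  set ξ : ℝ → ℝ := fun t => u₁ t + H t - m with hξ
  have hξC : IsControl ξ := huH.sub (IsControl.const m)
  have hξ0 : ∫ t in (0 : ℝ)..T, ξ t = 0 := by
    rw [intervalIntegral.integral_sub (huH.intervalIntegrable _ _) (by simp)]
    simp [hm]; field_simp; ring
  have h1 := hvar ξ hξC hξ0
  have h2 := hgC.integral_mul_primitive hξC T
  rw [← h1, hξ0, mul_zero] at h2
  have hsq : ∫ t in (0 : ℝ)..T, ξ t ^ 2 = 0 := by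
    have : ∀ t, ξ t ^ 2 = u₁ t * ξ t + H t * ξ t - m * ξ t := fun t => by simp only [hξ]; ring
    simp only [this]
    rw [intervalIntegral.integral_sub
      (((h₁.mul hξC).add (hHC.mul hξC)).intervalIntegrable _ _)
      ((hξC.const_mul m).intervalIntegrable _ _), intervalIntegral.integral_add
      ((h₁.mul hξC).intervalIntegrable _ _) ((hHC.mul hξC).intervalIntegrable _ _), h2,
      intervalIntegral.integral_const_mul, hξ0]
    ring
  refine ⟨a, b, m, ?_, ?_⟩
  · filter_upwards [hu₂] with t ht htm
    exact sub_eq_zero.1 (ht htm)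
  · filter_upwards [hξC.ae_eq_zero hT.le hsq.le] with t ht htm
    have := ht htm
    simp only [hξ] at this
    linarith

/-! ### Shortest paths are Lipschitz and have measurable controls -/

theorem ae_mem_Ioo_of_mem_Ioc (a b : ℝ) : ∀ᵐ t : ℝ, t ∈ Set.Ioc a b → t ∈ Set.Ioo a b := by
  have h : ∀ᵐ t : ℝ, t ≠ b := by rw [MeasureTheory.ae_iff]; simp
  filter_upwards [h] with t ht htm
  exact ⟨htm.1, lt_of_le_of_ne htm.2 ht⟩

theorem integral_congr_ae_Ioo {f g : ℝ → ℝ} {T t : ℝ} (ht : t ∈ Set.Icc 0 T)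
    (h : ∀ᵐ s, s ∈ Set.Ioo 0 T → f s = g s) : ∫ s in (0 : ℝ)..t, f s = ∫ s in (0 : ℝ)..t, g s := by
  refine intervalIntegral.integral_congr_ae ?_
  filter_upwards [h, ae_mem_Ioo_of_mem_Ioc 0 t] with s h1 h2 hs
  rw [Set.uIoc_of_le ht.1] at hs
  exact h1 ⟨(h2 hs).1, (h2 hs).2.trans_le ht.2⟩

/-- The derivative of a function, restricted to an open interval. -/
noncomputable def derivOn (f : ℝ → ℝ) (T : ℝ) : ℝ → ℝ := (Set.Ioo 0 T).indicator (deriv f)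

theorem derivOn_of_mem (f : ℝ → ℝ) {T t : ℝ} (ht : t ∈ Set.Ioo 0 T) : derivOn f T t = deriv f t :=
  Set.indicator_of_mem ht _

theorem isControl_derivOn {f : ℝ → ℝ} {T : ℝ} {K : NNReal}
    (hf : LipschitzOnWith K f (Set.Icc 0 T)) : IsControl (derivOn f T) := by
  refine ⟨(measurable_deriv f).indicator measurableSet_Ioo, fun R => ⟨K, K.2, fun t _ => ?_⟩⟩
  by_cases ht : t ∈ Set.Ioo 0 T
  · rw [derivOn_of_mem f ht]
    exact norm_deriv_le_of_lipschitzOn (Icc_mem_nhds ht.1 ht.2) hf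
  · simp [derivOn, Set.indicator_of_notMem ht]

/-- Lipschitz functions are absolutely continuous, hence primitives of their derivatives. -/
theorem eq_add_integral_derivOn {f : ℝ → ℝ} {T : ℝ} {K : NNReal}
    (hf : LipschitzOnWith K f (Set.Icc 0 T)) {t : ℝ} (ht : t ∈ Set.Icc 0 T) :
    f t = f 0 + ∫ s in (0 : ℝ)..t, derivOn f T s := by
  have h : LipschitzOnWith K f (Set.uIcc 0 t) := hf.mono (by
    rw [Set.uIcc_of_le ht.1]; exact Set.Icc_subset_Icc le_rfl ht.2)
  rw [integral_congr_ae_Ioo ht (g := deriv f)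
    (Filter.Eventually.of_forall fun s hs => derivOn_of_mem f hs),
    h.absolutelyContinuousOnInterval.integral_deriv_eq_sub]
  ring

theorem lipschitzOnWith_of_le {f : ℝ → ℝ} {T K : ℝ} (hK : 0 ≤ K)
    (h : ∀ s t, 0 ≤ s → s ≤ t → t ≤ T → |f t - f s| ≤ K * (t - s)) :
    LipschitzOnWith ⟨K, hK⟩ f (Set.Icc 0 T) := by
  refine LipschitzOnWith.of_dist_le_mul fun s hs t ht => ?_
  simp only [Real.dist_eq]
  rcases le_total s t with hst | hst
  · rw [abs_sub_comm, abs_sub_comm s, abs_of_nonneg (sub_nonneg.2 hst)]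
    exact h s t hs.1 hst ht.2
  · rw [abs_of_nonneg (sub_nonneg.2 hst)]
    exact h t s ht.1 hst hs.2

/-- Right difference quotients suffice; this turns the displacement estimates into constraints on
the velocity. -/
theorem abs_le_of_hasDerivAt {f h : ℝ → ℝ} {f' t δ : ℝ} (hf : HasDerivAt f f' t) (hδ : 0 < δ)
    (hh : Continuous h) (hle : ∀ r, 0 < r → r < δ → |f (t + r) - f t| ≤ r * h r) : |f'| ≤ h 0 := by
  refine le_of_tendsto_of_tendsto hf.tendsto_slope_zero_right.abs
    ((hh.tendsto 0).mono_left nhdsWithin_le_nhds) ?_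
  filter_upwards [Ioo_mem_nhdsGT hδ] with r hr
  rw [smul_eq_mul, abs_mul, abs_of_pos (inv_pos.2 hr.1), inv_mul_le_iff₀ hr.1]
  exact hle r hr.1 hr.2

/-- The curve `g` is a shortest path on `[0, T]`, parametrized by arc length. -/
def IsShortest (g : ℝ → SH2) (T : ℝ) : Prop :=
  ∀ s t, 0 ≤ s → s ≤ t → t ≤ T → sRdist (g s) (g t) = ENNReal.ofReal (t - s)

namespace IsShortest

variable {g : ℝ → SH2} {T : ℝ}

theorem displacement_le (h : IsShortest g T) {s t : ℝ} (hs : 0 ≤ s) (hst : s ≤ t) (ht : t ≤ T) :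
    |rapidity (g t) - rapidity (g s)| ≤ t - s ∧
    (∀ a b : ℝ, a ^ 2 + b ^ 2 = 1 → |a * (rapidity (g t) - rapidity (g s)) +
      b * (Real.cosh (rapidity (g s)) * (xCoord (g t) - xCoord (g s)) -
        Real.sinh (rapidity (g s)) * (yCoord (g t) - yCoord (g s)))| ≤
      (t - s) * Real.cosh (t - s)) ∧
    |Real.cosh (rapidity (g s)) * (yCoord (g t) - yCoord (g s)) -
        Real.sinh (rapidity (g s)) * (xCoord (g t) - xCoord (g s))| ≤
      (t - s) * Real.sinh (t - s) :=
  displacement_le_of_sRdist_le (sub_nonneg.2 hst) (h s t hs hst ht).le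

/-- The angle stays within T of its initial value, so inverting the boost at g(s) costs only a
bounded factor. In the constant, M bounds the entries of the boost and N the factors cosh(t - s) and
sinh(t - s). -/
theorem exists_lipschitz (h : IsShortest g T) : ∃ K : NNReal,
    LipschitzOnWith K (fun t => rapidity (g t)) (Set.Icc 0 T) ∧
    LipschitzOnWith K (fun t => xCoord (g t)) (Set.Icc 0 T) ∧
    LipschitzOnWith K (fun t => yCoord (g t)) (Set.Icc 0 T) := by
  set M := Real.cosh (|rapidity (g 0)| + T) with hM
  set N := Real.cosh T with hN
  have hM1 : 1 ≤ M := Real.one_le_cosh _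
  have hN1 : 1 ≤ N := Real.one_le_cosh _
  have hK : 0 ≤ 2 * M * N := by positivity
  have key : ∀ s t, 0 ≤ s → s ≤ t → t ≤ T →
      |xCoord (g t) - xCoord (g s)| ≤ 2 * M * N * (t - s) ∧
      |yCoord (g t) - yCoord (g s)| ≤ 2 * M * N * (t - s) := by
    intro s t hs hst ht
    obtain ⟨-, h2, h3⟩ := h.displacement_le hs hst ht
    have h1 := (h.displacement_le le_rfl hs (hst.trans ht)).1
    have hX := h2 0 1 (by norm_num)
    simp only [zero_mul, one_mul, zero_add] at hX
    set c := Real.cosh (rapidity (g s)) with hc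
    set σ := Real.sinh (rapidity (g s)) with hσ
    have hcs : c ^ 2 - σ ^ 2 = 1 := Real.cosh_sq_sub_sinh_sq _
    have hts : 0 ≤ t - s := sub_nonneg.2 hst
    have hφ : |rapidity (g s)| ≤ |rapidity (g 0)| + T := by
      have := abs_add_le (rapidity (g 0)) (rapidity (g s) - rapidity (g 0))
      rw [add_sub_cancel] at this
      linarith
    have hcM : |c| ≤ M := by
      rw [hc, abs_of_pos (Real.cosh_pos _)]
      exact Real.cosh_le_cosh.2 (hφ.trans (le_abs_self _))
    have hσM : |σ| ≤ M := by
      refine le_trans ?_ hcM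
      rw [hc, abs_of_pos (Real.cosh_pos _), hσ, Real.abs_sinh, ← Real.cosh_abs (rapidity (g s))]
      exact (Real.sinh_lt_cosh _).le
    have hN' : Real.cosh (t - s) ≤ N := Real.cosh_le_cosh.2 (by
      rw [abs_of_nonneg hts, abs_of_nonneg (by linarith)]; linarith)
    have hXN := hX.trans (mul_le_mul_of_nonneg_left hN' hts)
    have hYN := h3.trans (mul_le_mul_of_nonneg_left
      ((Real.sinh_lt_cosh _).le.trans hN') hts)
    set X := c * (xCoord (g t) - xCoord (g s)) - σ * (yCoord (g t) - yCoord (g s)) with hXd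
    set Y := c * (yCoord (g t) - yCoord (g s)) - σ * (xCoord (g t) - xCoord (g s)) with hYd
    have bound : ∀ u v, |u| ≤ (t - s) * N → |v| ≤ (t - s) * N →
        |c * u + σ * v| ≤ 2 * M * N * (t - s) := by
      intro u v hu hv
      have e1 := mul_le_mul hcM hu (abs_nonneg _) (by linarith)
      have e2 := mul_le_mul hσM hv (abs_nonneg _) (by linarith)
      rw [← abs_mul] at e1 e2
      have := abs_add_le (c * u) (σ * v)
      linarith
    constructor
    · have e : xCoord (g t) - xCoord (g s) = c * X + σ * Y := by
        rw [hXd, hYd]; linear_combination -(xCoord (g t) - xCoord (g s)) * hcs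
      rw [e]; exact bound _ _ hXN hYN
    · have e : yCoord (g t) - yCoord (g s) = c * Y + σ * X := by
        rw [hXd, hYd]; linear_combination -(yCoord (g t) - yCoord (g s)) * hcs
      rw [e]; exact bound _ _ hYN hXN
  refine ⟨⟨2 * M * N, hK⟩, lipschitzOnWith_of_le hK fun s t hs hst ht => ?_,
    lipschitzOnWith_of_le hK fun s t hs hst ht => (key s t hs hst ht).1,
    lipschitzOnWith_of_le hK fun s t hs hst ht => (key s t hs hst ht).2⟩
  refine (h.displacement_le hs hst ht).1.trans ?_
  have : 1 ≤ 2 * M * N := by nlinarith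
  nlinarith [sub_nonneg.2 hst]

/-- At points of differentiability a shortest path is tangent to the distribution and has at most
unit speed. -/
theorem hasDerivAt_constraints (h : IsShortest g T) {t φ' x' y' : ℝ} (ht : t ∈ Set.Ioo 0 T)
    (hφ : HasDerivAt (fun t => rapidity (g t)) φ' t) (hx : HasDerivAt (fun t => xCoord (g t)) x' t)
    (hy : HasDerivAt (fun t => yCoord (g t)) y' t) :
    y' = x' / Real.cosh (rapidity (g t)) * Real.sinh (rapidity (g t)) ∧
      φ' ^ 2 + (x' / Real.cosh (rapidity (g t))) ^ 2 ≤ 1 := by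
  set c := Real.cosh (rapidity (g t)) with hc
  set σ := Real.sinh (rapidity (g t)) with hσ
  have hcs : c ^ 2 - σ ^ 2 = 1 := Real.cosh_sq_sub_sinh_sq _
  have hc0 : 0 < c := Real.cosh_pos _
  -- The displacement transverse to the distribution is at most r sinh r after time r, so its rate
  -- is at most sinh 0 = 0.
  have hY : |c * y' - σ * x'| ≤ Real.sinh 0 := by
    refine abs_le_of_hasDerivAt (((hy.sub_const (yCoord (g t))).const_mul c).sub
      ((hx.sub_const (xCoord (g t))).const_mul σ)) (sub_pos.2 ht.2) Real.continuous_sinh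
      fun r hr hr' => ?_
    simpa using (h.displacement_le ht.1.le (by linarith : t ≤ t + r) (by linarith)).2.2
  rw [Real.sinh_zero, abs_nonpos_iff, sub_eq_zero] at hY
  have hX : ∀ a b : ℝ, a ^ 2 + b ^ 2 = 1 → |a * φ' + b * (c * x' - σ * y')| ≤ Real.cosh 0 := by
    intro a b hab
    refine abs_le_of_hasDerivAt (((hφ.sub_const (rapidity (g t))).const_mul a).add
      ((((hx.sub_const (xCoord (g t))).const_mul c).sub
      ((hy.sub_const (yCoord (g t))).const_mul σ)).const_mul b)) (sub_pos.2 ht.2)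
      Real.continuous_cosh fun r hr hr' => ?_
    simpa using (h.displacement_le ht.1.le (by linarith : t ≤ t + r) (by linarith)).2.1 a b hab
  rw [Real.cosh_zero] at hX
  have hy' : y' = x' / c * σ := by field_simp; linarith
  refine ⟨hy', ?_⟩
  have hw : c * x' - σ * y' = x' / c := by
    rw [hy']; field_simp; linear_combination x' * hcs
  rw [hw] at hX
  set w := x' / c
  by_contra! hlt
  set n := Real.sqrt (φ' ^ 2 + w ^ 2) with hn
  have hnsq : n ^ 2 = φ' ^ 2 + w ^ 2 := Real.sq_sqrt (by positivity)
  have hn0 : 0 < n := Real.sqrt_pos.2 (by linarith)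
  -- Testing against the direction of the velocity itself turns the bounds on linear forms into n ≤
  -- 1.
  have := hX (φ' / n) (w / n) (by rw [div_pow, div_pow, ← add_div, ← hnsq]; field_simp)
  have e : φ' / n * φ' + w / n * w = n := by
    rw [div_mul_eq_mul_div, div_mul_eq_mul_div, ← add_div, div_eq_iff hn0.ne']; linarith
  rw [e, abs_of_pos hn0] at this
  nlinarith

/-- A shortest path is given by measurable controls. -/
theorem exists_controls (h : IsShortest g T) : ∃ u₁ u₂ φ : ℝ → ℝ, IsControl u₁ ∧ IsControl u₂ ∧
    (∀ t, φ t = rapidity (g 0) + ∫ s in (0 : ℝ)..t, u₁ s) ∧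
    (∀ᵐ t, t ∈ Set.Ioo 0 T → u₁ t ^ 2 + u₂ t ^ 2 ≤ 1) ∧
    ∀ t ∈ Set.Icc 0 T, rapidity (g t) = φ t ∧
      xCoord (g t) = xCoord (g 0) + (∫ s in (0 : ℝ)..t, u₂ s * Real.cosh (φ s)) ∧
      yCoord (g t) = yCoord (g 0) + ∫ s in (0 : ℝ)..t, u₂ s * Real.sinh (φ s) := by
  obtain ⟨K, hφ, hx, hy⟩ := h.exists_lipschitz
  have c₁ := isControl_derivOn hφ
  set u₁ := derivOn (fun t => rapidity (g t)) T with hu₁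
  set φ : ℝ → ℝ := fun t => rapidity (g 0) + ∫ s in (0 : ℝ)..t, u₁ s with hφd
  have hφc : Continuous φ := continuous_const.add (c₁.continuous_integral 0)
  -- Dividing by cosh φ, with φ the primitive of u₁, instead of using the angle of g keeps the
  -- denominator continuous on all of ℝ.
  set u₂ : ℝ → ℝ := fun t => derivOn (fun t => xCoord (g t)) T t * (Real.cosh (φ t))⁻¹ with hu₂
  have c₂ : IsControl u₂ := (isControl_derivOn hx).mul (IsControl.of_continuous
    ((Real.continuous_cosh.comp hφc).inv₀ fun t => (Real.cosh_pos _).ne'))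
  have hφe : ∀ t ∈ Set.Icc 0 T, rapidity (g t) = φ t := fun t ht => eq_add_integral_derivOn hφ ht
  have hae : ∀ᵐ t, t ∈ Set.Ioo 0 T → u₁ t ^ 2 + u₂ t ^ 2 ≤ 1 ∧
      derivOn (fun t => xCoord (g t)) T t = u₂ t * Real.cosh (φ t) ∧
      derivOn (fun t => yCoord (g t)) T t = u₂ t * Real.sinh (φ t) := by
    have hac : ∀ {f : ℝ → ℝ}, LipschitzOnWith K f (Set.Icc 0 T) →
        ∀ᵐ t, t ∈ Set.Ioo 0 T → DifferentiableAt ℝ f t := fun {f} hf => by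
      rcases le_or_gt 0 T with hT | hT
      · rw [← Set.uIcc_of_le hT] at hf
        filter_upwards [hf.absolutelyContinuousOnInterval.ae_differentiableAt] with t ht htm
        exact ht (by rw [Set.uIcc_of_le hT]; exact Set.Ioo_subset_Icc_self htm)
      · exact Filter.Eventually.of_forall fun t ht => absurd (ht.1.trans ht.2) hT.le.not_gt
    filter_upwards [hac hφ, hac hx, hac hy] with t h1 h2 h3 ht
    obtain ⟨e1, e2⟩ := h.hasDerivAt_constraints ht (h1 ht).hasDerivAt (h2 ht).hasDerivAt
      (h3 ht).hasDerivAt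
    rw [hφe t (Set.Ioo_subset_Icc_self ht)] at e1 e2
    have hc := (Real.cosh_pos (φ t)).ne'
    simp only [hu₂, hu₁, derivOn_of_mem _ ht]
    refine ⟨by rwa [← div_eq_mul_inv], by field_simp, by rw [e1]; field_simp⟩
  refine ⟨u₁, u₂, φ, c₁, c₂, fun _ => rfl, hae.mono fun t ht htm => (ht htm).1, fun t ht =>
    ⟨hφe t ht, ?_, ?_⟩⟩
  · rw [eq_add_integral_derivOn hx ht,
      integral_congr_ae_Ioo ht (hae.mono fun s hs hsm => (hs hsm).2.1)]
  · rw [eq_add_integral_derivOn hy ht,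
      integral_congr_ae_Ioo ht (hae.mono fun s hs hsm => (hs hsm).2.2)]

end IsShortest

/-! ### The geodesic equations for shortest paths -/

/-- The geodesic equations with unit speed at the time `t`: the covector is
`C e₁ + A e₂ + B e₃`. -/
structure IsExtremalAt (g : ℝ → SH2) (A B C t : ℝ) : Prop where
  rapidity : HasDerivAt (fun t => rapidity (g t)) (C - A * yCoord (g t) - B * xCoord (g t)) t
  xCoord : HasDerivAt (fun t => xCoord (g t)) ((A * Real.cosh (SH2.rapidity (g t)) +
    B * Real.sinh (SH2.rapidity (g t))) * Real.cosh (SH2.rapidity (g t))) t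
  yCoord : HasDerivAt (fun t => yCoord (g t)) ((A * Real.cosh (SH2.rapidity (g t)) +
    B * Real.sinh (SH2.rapidity (g t))) * Real.sinh (SH2.rapidity (g t))) t
  speed : (C - A * SH2.yCoord (g t) - B * SH2.xCoord (g t)) ^ 2 +
    (A * Real.cosh (SH2.rapidity (g t)) + B * Real.sinh (SH2.rapidity (g t))) ^ 2 = 1

/-- The controls of a shortest path have the least energy. -/
theorem IsShortest.le_energy {g : ℝ → SH2} {T : ℝ} (h : IsShortest g T) (hT : 0 < T)
    {v w : ℝ → ℝ} (hv : IsControl v) (hw : IsControl w)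
    (e₁ : rapidity (g T) = rapidity (g 0) + ∫ t in (0 : ℝ)..T, v t)
    (e₂ : xCoord (g T) = xCoord (g 0) +
      ∫ t in (0 : ℝ)..T, w t * Real.cosh (rapidity (g 0) + ∫ s in (0 : ℝ)..t, v s))
    (e₃ : yCoord (g T) = yCoord (g 0) +
      ∫ t in (0 : ℝ)..T, w t * Real.sinh (rapidity (g 0) + ∫ s in (0 : ℝ)..t, v s)) :
    T ≤ ∫ t in (0 : ℝ)..T, (v t ^ 2 + w t ^ 2) := by
  have hd := sRdist_le_of_isControl hv hw (rapidity (g 0)) (xCoord (g 0)) (yCoord (g 0)) hT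
  rw [← e₁, ← e₂, ← e₃, ofCoords_coords, ofCoords_coords, h 0 T le_rfl hT.le le_rfl, sub_zero,
    ENNReal.ofReal_le_ofReal_iff (Real.sqrt_nonneg _), Real.le_sqrt' hT, sq] at hd
  exact le_of_mul_le_mul_left hd hT

theorem hasDerivAt_of_eqOn_integral {f F v : ℝ → ℝ} {T z t : ℝ} (hF : Continuous F)
    (hfv : ∀ t ∈ Set.Icc 0 T, f t = z + ∫ s in (0 : ℝ)..t, v s)
    (hv : ∀ᵐ s, s ∈ Set.Ioo 0 T → v s = F s) (ht : t ∈ Set.Ioo 0 T) : HasDerivAt f (F t) t := by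
  refine ((hasDerivAt_integral_of_continuous hF 0 t).const_add z).congr_of_eventuallyEq ?_
  filter_upwards [Ioo_mem_nhds ht.1 ht.2] with s hs
  rw [hfv s (Set.Ioo_subset_Icc_self hs), integral_congr_ae_Ioo (Set.Ioo_subset_Icc_self hs) hv]

/-- A shortest path with varying hyperbolic angle satisfies the geodesic equations. -/
theorem IsShortest.exists_isExtremalAt_of_ne {g : ℝ → SH2} {T : ℝ} (h : IsShortest g T)
    (hT : 0 < T) (hne : ∃ t ∈ Set.Icc 0 T, rapidity (g t) ≠ rapidity (g 0)) :
    ∃ A B C : ℝ, ∀ t ∈ Set.Ioo 0 T, IsExtremalAt g A B C t := by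
  obtain ⟨u₁, u₂, φ, c₁, c₂, hφ, hu, hg⟩ := h.exists_controls
  have h0T : (0 : ℝ) ∈ Set.Icc 0 T := ⟨le_rfl, hT.le⟩
  have hTT : T ∈ Set.Icc 0 T := ⟨hT.le, le_rfl⟩
  have hφc : Continuous φ := by
    rw [show φ = fun t => rapidity (g 0) + ∫ s in (0 : ℝ)..t, u₁ s from funext hφ]
    exact continuous_const.add (c₁.continuous_integral 0)
  have hIoo := ae_mem_Ioo_of_mem_Ioc 0 T
  -- Speed at most 1 gives energy at most T, while every competitor has energy at least T by
  -- `IsShortest.le_energy`; so these controls are minimizers.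
  have hEu : ∫ t in (0 : ℝ)..T, (u₁ t ^ 2 + u₂ t ^ 2) ≤ T := by
    have h1 : ∫ t in (0 : ℝ)..T, (u₁ t ^ 2 + u₂ t ^ 2) ≤ ∫ t in (0 : ℝ)..T, (1 : ℝ) := by
      refine intervalIntegral.integral_mono_ae_restrict hT.le
        ((c₁.sq.add c₂.sq).intervalIntegrable _ _) (by simp) ?_
      refine (MeasureTheory.ae_restrict_iff' measurableSet_Icc).2 ?_
      have h0 : ∀ᵐ t : ℝ, t ≠ 0 := by rw [MeasureTheory.ae_iff]; simp
      filter_upwards [hu, hIoo, h0] with t h1 h2 h3 h4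
      exact h1 (h2 ⟨lt_of_le_of_ne h4.1 (Ne.symm h3), h4.2⟩)
    simpa using h1
  have hmul : ∀ {w ψ : ℝ → ℝ} (f : ℝ → ℝ), IsControl w → Continuous ψ → Continuous f →
      IntervalIntegrable (fun t => w t * f (ψ t)) MeasureTheory.volume 0 T :=
    fun f hw hψ hf => (hw.mul (IsControl.of_continuous (hf.comp hψ))).intervalIntegrable _ _
  obtain ⟨a, b, m, h₂, h₁⟩ := euler_lagrange c₁ c₂ hφ hT (fun v w ψ hv hw hψ hψT hp hq => by
    have hψc : Continuous ψ := by
      rw [show ψ = fun t => rapidity (g 0) + ∫ s in (0 : ℝ)..t, v s from funext hψ]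
      exact continuous_const.add (hv.continuous_integral 0)
    have hcosh : ∀ {w ψ : ℝ → ℝ}, IsControl w → Continuous ψ →
        ∫ t in (0 : ℝ)..T, w t * Real.cosh (ψ t) = ((∫ t in (0 : ℝ)..T, w t * Real.exp (ψ t)) +
          ∫ t in (0 : ℝ)..T, w t * Real.exp (-ψ t)) / 2 := fun {w ψ} hw hψ => by
      rw [← intervalIntegral.integral_add (hmul _ hw hψ Real.continuous_exp)
        (hmul (fun s => Real.exp (-s)) hw hψ (by fun_prop)), ← intervalIntegral.integral_div]
      congr 1; funext t; rw [Real.cosh_eq]; ring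
    have hsinh : ∀ {w ψ : ℝ → ℝ}, IsControl w → Continuous ψ →
        ∫ t in (0 : ℝ)..T, w t * Real.sinh (ψ t) = ((∫ t in (0 : ℝ)..T, w t * Real.exp (ψ t)) -
          ∫ t in (0 : ℝ)..T, w t * Real.exp (-ψ t)) / 2 := fun {w ψ} hw hψ => by
      rw [← intervalIntegral.integral_sub (hmul _ hw hψ Real.continuous_exp)
        (hmul (fun s => Real.exp (-s)) hw hψ (by fun_prop)), ← intervalIntegral.integral_div]
      congr 1; funext t; rw [Real.sinh_eq]; ring
    refine hEu.trans (h.le_energy hT hv hw ?_ ?_ ?_)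
    · rw [(hg T hTT).1, ← hψT, hψ]
    · simp only [← hψ]
      rw [(hg T hTT).2.1, hcosh c₂ hφc, hcosh hw hψc, hp, hq]
    · simp only [← hψ]
      rw [(hg T hTT).2.2, hsinh c₂ hφc, hsinh hw hψc, hp, hq]) (by
    obtain ⟨t, ht, hne⟩ := hne
    exact ⟨t, ht, by rwa [← (hg t ht).1, ← (hg 0 h0T).1]⟩)
  set P : ℝ → ℝ := fun t => a * Real.exp (φ t) + b * Real.exp (-φ t) with hP
  set H : ℝ → ℝ := fun t => ∫ s in (0 : ℝ)..t,
    (a ^ 2 * Real.exp (2 * φ s) - b ^ 2 * Real.exp (-2 * φ s)) with hH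
  have hPc : Continuous P := by fun_prop
  have hHc : Continuous H :=
    (IsControl.of_continuous (by fun_prop)).continuous_integral 0
  have hPe : ∀ t, P t = (a + b) * Real.cosh (φ t) + (a - b) * Real.sinh (φ t) := fun t => by
    rw [hP, Real.cosh_eq, Real.sinh_eq]; ring
  have hsub : Set.Ioo 0 T ⊆ Set.Ioc 0 T := Set.Ioo_subset_Ioc_self
  have h₁' : ∀ᵐ t, t ∈ Set.Ioo 0 T → u₁ t = m - H t := h₁.mono fun t ht htm => ht (hsub htm)
  have h₂' : ∀ᵐ t, t ∈ Set.Ioo 0 T → u₂ t = P t := h₂.mono fun t ht htm => ht (hsub htm)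
  -- With A = a + b and B = a - b, the integrand of H factors as P · (A sinh φ + B cosh φ), which is
  -- Ay' + Bx'.
  have hHe : ∀ t ∈ Set.Icc 0 T, H t = (a + b) * (yCoord (g t) - yCoord (g 0)) +
      (a - b) * (xCoord (g t) - xCoord (g 0)) := by
    intro t ht
    rw [(hg t ht).2.1, (hg t ht).2.2, add_sub_cancel_left, add_sub_cancel_left,
      integral_congr_ae_Ioo ht (f := fun s => u₂ s * Real.sinh (φ s))
        (g := fun s => P s * Real.sinh (φ s))
        (h₂'.mono fun s hs hsm => by rw [hs hsm]),
      integral_congr_ae_Ioo ht (f := fun s => u₂ s * Real.cosh (φ s))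
        (g := fun s => P s * Real.cosh (φ s))
        (h₂'.mono fun s hs hsm => by rw [hs hsm]),
      ← intervalIntegral.integral_const_mul, ← intervalIntegral.integral_const_mul,
      ← intervalIntegral.integral_add (Continuous.intervalIntegrable (by fun_prop) _ _)
        (Continuous.intervalIntegrable (by fun_prop) _ _)]
    refine intervalIntegral.integral_congr fun s _ => ?_
    simp only [hP]
    rw [Real.cosh_eq, Real.sinh_eq, exp_two_mul, exp_neg_two_mul]
    ring
  have dφ : ∀ t ∈ Set.Ioo 0 T, HasDerivAt (fun t => rapidity (g t)) (m - H t) t := fun t ht =>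
    hasDerivAt_of_eqOn_integral (F := fun t => m - H t) (by fun_prop)
      (fun s hs => (hg s hs).1.trans (hφ s)) h₁' ht
  have dx : ∀ t ∈ Set.Ioo 0 T, HasDerivAt (fun t => xCoord (g t)) (P t * Real.cosh (φ t)) t :=
    fun t ht => hasDerivAt_of_eqOn_integral (F := fun t => P t * Real.cosh (φ t)) (by fun_prop)
      (fun s hs => (hg s hs).2.1) (h₂'.mono fun s hs hsm => by rw [hs hsm]) ht
  have dy : ∀ t ∈ Set.Ioo 0 T, HasDerivAt (fun t => yCoord (g t)) (P t * Real.sinh (φ t)) t :=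
    fun t ht => hasDerivAt_of_eqOn_integral (F := fun t => P t * Real.sinh (φ t)) (by fun_prop)
      (fun s hs => (hg s hs).2.2) (h₂'.mono fun s hs hsm => by rw [hs hsm]) ht
  -- the speed
  set S : ℝ → ℝ := fun t => (m - H t) ^ 2 + P t ^ 2 with hS
  have hSc : Continuous S := by fun_prop
  have hSle : ∀ t ∈ Set.Icc 0 T, S t ≤ 1 := by
    intro t ht
    rw [← closure_Ioo hT.ne] at ht
    refine le_on_closure (fun t ht => ?_) hSc.continuousOn continuousOn_const ht
    have := (h.hasDerivAt_constraints ht (dφ t ht) (dx t ht) (dy t ht)).2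
    rwa [(hg t (Set.Ioo_subset_Icc_self ht)).1, mul_div_cancel_right₀ _ (Real.cosh_pos _).ne']
      at this
  have hSint : T ≤ ∫ t in (0 : ℝ)..T, S t := by
    rw [← integral_congr_ae_Ioo hTT (f := fun t => u₁ t ^ 2 + u₂ t ^ 2) (by
      filter_upwards [h₁', h₂'] with t ht ht' htm
      rw [ht htm, ht' htm])]
    refine h.le_energy hT c₁ c₂ ?_ ?_ ?_
    · rw [(hg T hTT).1, hφ]
    · simp only [← hφ]; exact (hg T hTT).2.1
    · simp only [← hφ]; exact (hg T hTT).2.2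
  -- A continuous function that is at most 1 and has integral at least T on [0, T] is identically 1.
  have hS1 : ∀ t ∈ Set.Icc 0 T, S t = 1 := by
    intro t ht
    by_contra hne
    have hlt : 0 < 1 - S t := sub_pos.2 (lt_of_le_of_ne (hSle t ht) hne)
    have := intervalIntegral.integral_pos (f := fun t => 1 - S t) hT (by fun_prop)
      (fun s hs => sub_nonneg.2 (hSle s (Set.Ioc_subset_Icc_self hs))) ⟨t, ht, hlt⟩
    rw [intervalIntegral.integral_sub (by simp) (hSc.intervalIntegrable _ _)] at this
    simp at this
    linarith
  refine ⟨a + b, a - b, m + (a + b) * yCoord (g 0) + (a - b) * xCoord (g 0), fun t ht => ?_⟩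
  have ht' := Set.Ioo_subset_Icc_self ht
  have eH : m + (a + b) * yCoord (g 0) + (a - b) * xCoord (g 0) - (a + b) * yCoord (g t) -
      (a - b) * xCoord (g t) = m - H t := by rw [hHe t ht']; ring
  have eP : (a + b) * Real.cosh (rapidity (g t)) + (a - b) * Real.sinh (rapidity (g t)) = P t := by
    rw [hPe, (hg t ht').1]
  refine ⟨?_, ?_, ?_, ?_⟩
  · rw [eH]; exact dφ t ht
  · rw [eP, (hg t ht').1]; exact dx t ht
  · rw [eP, (hg t ht').1]; exact dy t ht
  · rw [eH, eP]; exact hS1 t ht'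

/-- A shortest path with constant hyperbolic angle is a straight line, and satisfies the geodesic
equations. -/
theorem IsShortest.exists_isExtremalAt_of_eq {g : ℝ → SH2} {T : ℝ} (h : IsShortest g T)
    (hT : 0 < T) (heq : ∀ t ∈ Set.Icc 0 T, rapidity (g t) = rapidity (g 0)) :
    ∃ A B C : ℝ, ∀ t ∈ Set.Ioo 0 T, IsExtremalAt g A B C t := by
  obtain ⟨u₁, u₂, φ, c₁, c₂, hφ, hu, hg⟩ := h.exists_controls
  set φ₀ := rapidity (g 0) with hφ₀
  set c := Real.cosh φ₀ with hc
  set σ := Real.sinh φ₀ with hσ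
  have hcs : c ^ 2 - σ ^ 2 = 1 := Real.cosh_sq_sub_sinh_sq _
  have hTT : T ∈ Set.Icc 0 T := ⟨hT.le, le_rfl⟩
  set W : ℝ → ℝ := fun t => ∫ s in (0 : ℝ)..t, u₂ s with hW
  have hW0 : W 0 = 0 := by simp [hW]
  have hxW : ∀ t ∈ Set.Icc 0 T, xCoord (g t) = xCoord (g 0) + W t * c := fun t ht => by
    rw [(hg t ht).2.1, hW, ← intervalIntegral.integral_mul_const]
    congr 1
    refine integral_congr_ae_Ioo ht (Filter.Eventually.of_forall fun s hs => ?_)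
    rw [← (hg s (Set.Ioo_subset_Icc_self hs)).1, heq s (Set.Ioo_subset_Icc_self hs)]
  have hyW : ∀ t ∈ Set.Icc 0 T, yCoord (g t) = yCoord (g 0) + W t * σ := fun t ht => by
    rw [(hg t ht).2.2, hW, ← intervalIntegral.integral_mul_const]
    congr 1
    refine integral_congr_ae_Ioo ht (Filter.Eventually.of_forall fun s hs => ?_)
    rw [← (hg s (Set.Ioo_subset_Icc_self hs)).1, heq s (Set.Ioo_subset_Icc_self hs)]
  have hlip : ∀ s t, 0 ≤ s → s ≤ t → t ≤ T → |W t - W s| ≤ t - s := by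
    intro s t hs hst ht
    simp only [hW]
    rw [intervalIntegral.integral_interval_sub_left (c₂.intervalIntegrable _ _)
      (c₂.intervalIntegrable _ _), ← Real.norm_eq_abs]
    have := intervalIntegral.norm_integral_le_of_norm_le (f := u₂) (g := fun _ => 1)
      (μ := MeasureTheory.volume) hst (by
        filter_upwards [hu, ae_mem_Ioo_of_mem_Ioc s t] with r h1 h2 hr
        have := h1 ⟨hs.trans_lt (h2 hr).1, (h2 hr).2.trans_le ht⟩
        exact abs_le_one_iff_mul_self_le_one.2 (by nlinarith [sq_nonneg (u₁ r)])) (by simp)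
    simpa using this
  -- The straight path to the end point has length |W(T)|, which is not less than the distance T.
  have hfar : T ≤ |W T| := by
    have hd := sRdist_translate_le φ₀ (xCoord (g 0)) (yCoord (g 0)) (W T)
    rw [← hc, ← hσ, ← hxW T hTT, ← hyW T hTT, ofCoords_coords, ← heq T hTT, ofCoords_coords,
      h 0 T le_rfl hT.le le_rfl, sub_zero, ENNReal.ofReal_le_ofReal_iff (abs_nonneg _)] at hd
    exact hd
  -- W is 1-Lipschitz and |W(T)| ≥ T, so there is no slack: W(t) = t throughout or W(t) = -t
  -- throughout.
  obtain ⟨ε, hε, hWε⟩ : ∃ ε : ℝ, ε ^ 2 = 1 ∧ ∀ t ∈ Set.Icc 0 T, W t = ε * t := by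
    have hl : ∀ t ∈ Set.Icc 0 T, |W t| ≤ t ∧ |W T - W t| ≤ T - t := fun t ht => by
      have := hlip 0 t le_rfl ht.1 ht.2
      rw [hW0, sub_zero, sub_zero] at this
      exact ⟨this, hlip t T ht.1 ht.2 le_rfl⟩
    rcases le_abs.1 hfar with h' | h'
    · refine ⟨1, by norm_num, fun t ht => ?_⟩
      obtain ⟨h1, h2⟩ := hl t ht
      rw [abs_le] at h1 h2
      linarith
    · refine ⟨-1, by norm_num, fun t ht => ?_⟩
      obtain ⟨h1, h2⟩ := hl t ht
      rw [abs_le] at h1 h2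
      linarith
  -- A and B make the second control ε at the angle φ₀ and the third momentum Aσ + Bc zero; C makes
  -- the first control vanish.
  refine ⟨ε * c, -(ε * σ), ε * c * yCoord (g 0) - ε * σ * xCoord (g 0), fun t ht => ?_⟩
  have ht' := Set.Ioo_subset_Icc_self ht
  have hnear : ∀ᶠ s in nhds t, s ∈ Set.Icc 0 T := Icc_mem_nhds ht.1 ht.2
  have e₁ : ε * c * yCoord (g 0) - ε * σ * xCoord (g 0) - ε * c * yCoord (g t) -
      -(ε * σ) * xCoord (g t) = 0 := by
    rw [hxW t ht', hyW t ht']; ring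
  have e₂ : ε * c * Real.cosh (rapidity (g t)) + -(ε * σ) * Real.sinh (rapidity (g t)) = ε := by
    rw [heq t ht']; linear_combination ε * hcs
  refine ⟨?_, ?_, ?_, ?_⟩
  · rw [e₁]
    exact (hasDerivAt_const t φ₀).congr_of_eventuallyEq (hnear.mono fun s hs => heq s hs)
  · rw [e₂, heq t ht']
    refine HasDerivAt.congr_of_eventuallyEq (f := fun s => xCoord (g 0) + ε * s * c) ?_
      (hnear.mono fun s hs => by simp only [hxW s hs, hWε s hs])
    simpa using (((hasDerivAt_id t).const_mul ε).mul_const c).const_add (xCoord (g 0))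
  · rw [e₂, heq t ht']
    refine HasDerivAt.congr_of_eventuallyEq (f := fun s => yCoord (g 0) + ε * s * σ) ?_
      (hnear.mono fun s hs => by simp only [hyW s hs, hWε s hs])
    simpa using (((hasDerivAt_id t).const_mul ε).mul_const σ).const_add (yCoord (g 0))
  · rw [e₁, e₂, hε]; norm_num

theorem IsShortest.exists_isExtremalAt {g : ℝ → SH2} {T : ℝ} (h : IsShortest g T)
    (hT : 0 < T) : ∃ A B C : ℝ, ∀ t ∈ Set.Ioo 0 T, IsExtremalAt g A B C t := by
  by_cases hne : ∃ t ∈ Set.Icc 0 T, rapidity (g t) ≠ rapidity (g 0)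
  · exact h.exists_isExtremalAt_of_ne hT hne
  · push Not at hne
    exact h.exists_isExtremalAt_of_eq hT hne

/-! ### Gluing the local covectors -/

theorem IsExtremalAt.comp_add {g : ℝ → SH2} {A B C t s : ℝ}
    (h : IsExtremalAt (fun r => g (r + s)) A B C t) : IsExtremalAt g A B C (t + s) := by
  have key : ∀ {f : ℝ → ℝ} {f' : ℝ}, HasDerivAt (fun r => f (r + s)) f' t →
      HasDerivAt f f' (t + s) := fun {f f'} hf => by
    rw [show t = t + s - s by ring] at hf
    simpa using hf.comp_sub_const (t + s) s
  exact ⟨key (f := fun r => SH2.rapidity (g r)) h.rapidity,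
    key (f := fun r => SH2.xCoord (g r)) h.xCoord,
    key (f := fun r => SH2.yCoord (g r)) h.yCoord, h.speed⟩

/-- The covector of an extremal is determined by the extremal near any of its points. -/
theorem isExtremalAt_unique {g : ℝ → SH2} {A B C A' B' C' t : ℝ}
    (h : ∀ᶠ s in nhds t, IsExtremalAt g A B C s) (h' : ∀ᶠ s in nhds t, IsExtremalAt g A' B' C' s) :
    A = A' ∧ B = B' ∧ C = C' := by
  have e₁ : ∀ᶠ s in nhds t, C - A * yCoord (g s) - B * xCoord (g s) =
      C' - A' * yCoord (g s) - B' * xCoord (g s) := by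
    filter_upwards [h, h'] with s hs hs'
    exact hs.rapidity.unique hs'.rapidity
  have e₂ : ∀ᶠ s in nhds t, A * Real.cosh (rapidity (g s)) + B * Real.sinh (rapidity (g s)) =
      A' * Real.cosh (rapidity (g s)) + B' * Real.sinh (rapidity (g s)) := by
    filter_upwards [h, h'] with s hs hs'
    exact mul_right_cancel₀ (Real.cosh_pos _).ne' (hs.xCoord.unique hs'.xCoord)
  have k := h.self_of_nhds
  have k' := h'.self_of_nhds
  have d₁ := (((k.yCoord.const_mul A).const_sub C).sub (k.xCoord.const_mul B)).unique
    ((((k'.yCoord.const_mul A').const_sub C').sub (k'.xCoord.const_mul B')).congr_of_eventuallyEq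
      e₁)
  have d₂ := ((k.rapidity.cosh.const_mul A).add (k.rapidity.sinh.const_mul B)).unique
    (((k'.rapidity.cosh.const_mul A').add (k'.rapidity.sinh.const_mul B')).congr_of_eventuallyEq
      e₂)
  have f₁ := e₁.self_of_nhds
  have f₂ := e₂.self_of_nhds
  have hs := k.speed
  rw [← f₁] at d₂
  rw [← f₂] at d₁
  set u := C - A * yCoord (g t) - B * xCoord (g t)
  set v := A * Real.cosh (rapidity (g t)) + B * Real.sinh (rapidity (g t))
  set c := Real.cosh (rapidity (g t))
  set σ := Real.sinh (rapidity (g t))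
  have hcs : c ^ 2 - σ ^ 2 = 1 := Real.cosh_sq_sub_sinh_sq _
  -- The derivatives of the controls are this third momentum multiplied by -v and by u. By u² + v² =
  -- 1 one of the factors is nonzero, so it is determined; A and B follow by inverting the boost.
  have h₃ : A * σ + B * c = A' * σ + B' * c := by
    linear_combination (A' * σ + B' * c - A * σ - B * c) * hs + u * d₂ - v * d₁
  have f₂' : A * c + B * σ = A' * c + B' * σ := f₂
  have hA : A = A' := by
    linear_combination (A' - A) * hcs + c * f₂' - σ * h₃
  have hB : B = B' := by
    linear_combination (B' - B) * hcs + c * h₃ - σ * f₂'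
  refine ⟨hA, hB, ?_⟩
  rw [← hA, ← hB] at f₁
  simp only [u] at f₁
  linarith

/-- Around each time a shortest piece, shifted to start at 0, supplies a covector. Uniqueness on
overlaps makes the choice locally constant, and ℝ is connected. -/
theorem IsGeodesic.exists_isExtremalAt {g : ℝ → SH2} (hg : IsGeodesic g) :
    ∃ A B C : ℝ, ∀ t, IsExtremalAt g A B C t := by
  have hloc : ∀ t, ∃ q : ℝ × ℝ × ℝ, ∀ᶠ s in nhds t, IsExtremalAt g q.1 q.2.1 q.2.2 s := by
    intro t
    obtain ⟨ε, hε, h⟩ := hg t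
    have hsh : IsShortest (fun r => g (r + (t - ε))) (2 * ε) := fun r s hr hrs hs => by
      rw [h (r + (t - ε)) ⟨by linarith, by linarith⟩ (s + (t - ε)) ⟨by linarith, by linarith⟩
        (by linarith)]
      congr 1; ring
    obtain ⟨A, B, C, hE⟩ := hsh.exists_isExtremalAt (by linarith)
    refine ⟨(A, B, C), ?_⟩
    filter_upwards [Ioo_mem_nhds (by linarith : t - ε < t) (by linarith : t < t + ε)] with s hs
    simpa using (hE (s - (t - ε)) ⟨by linarith [hs.1], by linarith [hs.2]⟩).comp_add
  choose q hq using hloc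
  have hconst : IsLocallyConstant q := by
    rw [IsLocallyConstant.iff_eventually_eq]
    intro t
    filter_upwards [(hq t).eventually_nhds] with s hs
    obtain ⟨h1, h2, h3⟩ := isExtremalAt_unique (hq s) hs
    exact Prod.ext h1 (Prod.ext h2 h3)
  refine ⟨(q 0).1, (q 0).2.1, (q 0).2.2, fun t => ?_⟩
  rw [hconst.apply_eq_of_preconnectedSpace 0 t]
  exact (hq t).self_of_nhds

theorem exists_cos_sin_eq {u v : ℝ} (h : u ^ 2 + v ^ 2 = 1) :
    ∃ α, Real.cos α = u ∧ Real.sin α = v := by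
  have hn : ‖(⟨u, v⟩ : ℂ)‖ = 1 := by
    rw [Complex.norm_eq_sqrt_sq_add_sq, h, Real.sqrt_one]
  have h0 : (⟨u, v⟩ : ℂ) ≠ 0 := fun h => by simp [h] at hn
  exact ⟨Complex.arg ⟨u, v⟩, by rw [Complex.cos_arg h0, hn, div_one],
    by rw [Complex.sin_arg, hn, div_one]⟩

theorem IsGeodesic.exists_isExtremal {g : ℝ → SH2} (hg : IsGeodesic g) (h0 : g 0 = 1) :
    ∃ α β : ℝ, IsExtremal (covector α β) g := by
  obtain ⟨A, B, C, h⟩ := hg.exists_isExtremalAt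
  have hs := (h 0).speed
  simp only [h0, rapidity_one, xCoord_one, yCoord_one, Real.cosh_zero, Real.sinh_zero, mul_zero,
    mul_one, sub_zero, add_zero] at hs
  -- At the identity unit speed reads C² + A² = 1, which supplies the angle α; B is β.
  obtain ⟨α, hC, hA⟩ := exists_cos_sin_eq hs
  refine ⟨α, B, (isExtremal_covector_iff α B g).2 fun t => ?_⟩
  rw [hC, hA, mul_comm (yCoord (g t))]
  exact ⟨(h t).rapidity, (h t).xCoord, (h t).yCoord⟩

end SH2

theorem mainTheorem11 :
    (∀ g : ℝ → SH2, SH2.IsGeodesic g → g 0 = 1 →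
      ∃ α β : ℝ, SH2.IsExtremal (SH2.covector α β) g) ∧
    (∀ (α β : ℝ) (g : ℝ → SH2), SH2.IsExtremal (SH2.covector α β) g → g 0 = 1 →
      ∃ φ x y γ : ℝ → ℝ,
        (∀ t, SH2.toMat (g t) = shMat (φ t) (x t) (y t)) ∧
        φ 0 = 0 ∧ x 0 = 0 ∧ y 0 = 0 ∧
        (∀ t, Real.cos (γ t / 2) = Real.sin α * Real.cosh (φ t) + β * Real.sinh (φ t)) ∧
        (∀ t, Real.sin (γ t / 2) = Real.cos α - y t * Real.sin α - β * x t) ∧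
        (∀ t, HasDerivAt φ (Real.sin (γ t / 2)) t) ∧
        (∀ t, HasDerivAt x (Real.cos (γ t / 2) * Real.cosh (φ t)) t) ∧
        (∀ t, HasDerivAt y (Real.cos (γ t / 2) * Real.sinh (φ t)) t) ∧
        (∀ t, DifferentiableAt ℝ γ t) ∧
        (∀ t, HasDerivAt (deriv γ) (-Real.sin (γ t)) t) ∧
        γ 0 = Real.pi - 2 * α ∧ deriv γ 0 = -2 * β) := by
  exact ⟨fun g hg h0 => hg.exists_isExtremal h0, fun α β g hg h0 => hg.exists_pendulum h0⟩
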